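/- Consider a $K$-tier downlink cellular network, $K\ge 1$, with path-loss exponent $\eta=4$, no noise, and a test user at the origin of $\mathbb R^2$. The base stations (BSs) of tier $i\in\{1,\dots,K\}$ form a homogeneous Poisson point process $\{x_{i,n}\}_{n}$ of intensity $\lambda_i>0$; the tiers are mutually independent. All BSs of tier $i$ transmit with power $P_i>0$ and have bias factor $B_i>0$. The fading coefficients $h_{i,n}$ are i.i.d. circularly symmetric complex Gaussian $\mathcal{CN}(0,1)$ (Rayleigh fading), independent of all BS locations. Let $r_{0,i}=\min_n\|x_{i,n}\|$. The user associates with tier $k$ (and is then served by the nearest BS of that tier) if $B_kP_kr_{0,k}^{-4}>B_iP_ir_{0,i}^{-4}$ for all $i\ne k$; let $\mathcal A_k$ be the probability of this event. For a user served by tier $k$, let $$\mathcal I^{(k)}=\sum_{(i,n)\,:\,x_{i,n}\text{ not the serving BS}}P_i|h_{i,n}|^2\|x_{i,n}\|^{-4}$$ be the aggregate interference power. For $a\ge 0$ define the spatially averaged Laplace transforms $$\mathcal L^{(k)}(a)=\mathbb E\Big[\exp\Big(-\tfrac{a\,r_{0,k}^4}{P_k}\,\mathcal I^{(k)}\Big)\,\Big|\,\text{the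 user associates with tier }k\Big],\qquad \mathcal L(a)=\sum_{k=1}^K\mathcal A_k\,\mathcal L^{(k)}(a).$$ Then $\mathcal I^{(k)}<\infty$ almost surely for every $k$, and for all $k$ and all $a\ge0$: $$\mathcal A_k=\frac{\lambda_k\sqrt{B_kP_k}}{\sum_{i=1}^K\lambda_i\sqrt{B_iP_i}},$$ $$\mathcal L^{(k)}(a)=\frac{\sum_{i=1}^K\sqrt{B_iP_i}\,\lambda_i}{\sum_{l=1}^K\sqrt{B_lP_l}\,\lambda_l\Big(1+\sqrt{\tfrac{aB_k}{B_l}}\arctan\sqrt{\tfrac{aB_k}{B_l}}\Big)},$$ $$\mathcal L(a)=\sum_{k=1}^K\Bigg(\sum_{i=1}^K\frac{\lambda_i}{\lambda_k}\sqrt{\frac{B_iP_i}{B_kP_k}}\Big[1+\sqrt{\tfrac{aB_k}{B_i}}\arctan\sqrt{\tfrac{aB_k}{B_i}}\Big]\Bigg)^{-1}.$$ Without biasing, i.e. if all $B_i$ are equal (in particular if $B_i=1$ for all $i$), $$\mathcal L(a)=\frac{1}{1+\sqrt a\,\arctan\sqrt a},$$ which does not depend on the powers, the intensities or the number of tiers.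 -/

import Mathlib

open MeasureTheory ProbabilityTheory
open scoped NNReal ENNReal

namespace MultiTier

/-- The plane in which the base stations (BSs) are located. The test user sits at the origin. -/
abbrev Plane : Type := EuclideanSpace ℝ (Fin 2)

/-- The number of points of the enumerated point process `X` that fall in the set `A`. -/
noncomputable def count {Ω : Type*} (X : ℕ → Ω → Plane) (A : Set Plane) (ω : Ω) : ℕ∞ :=
  {n : ℕ | X n ω ∈ A}.encard

/-- The random points `X 0, X 1, …` form (an enumeration of) a homogeneous Poisson point process
of intensity `lam` in the plane: the numbers of points in finitely many pairwise disjoint bounded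
Borel sets are independent and Poisson distributed, with means `lam` times the areas. The order of
the enumeration is arbitrary. -/
structure IsPoissonPointProcess {Ω : Type*} [MeasurableSpace Ω] (μ : Measure Ω)
    (lam : ℝ) (X : ℕ → Ω → Plane) : Prop where
  measurable : ∀ n, Measurable (X n)
  count_law : ∀ (m : ℕ) (A : Fin m → Set Plane),
    (∀ j, MeasurableSet (A j)) → (∀ j, Bornology.IsBounded (A j)) →
    Pairwise (fun j l => Disjoint (A j) (A l)) →
    ∀ N : Fin m → ℕ,
      μ {ω | ∀ j, count X (A j) ω = (N j : ℕ∞)} =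
        ∏ j, poissonMeasure (Real.toNNReal (lam * (volume (A j)).toReal)) {N j}

/-- The law `𝒞𝒩(0,1)` of a circularly symmetric complex Gaussian of unit variance: real and
imaginary parts are independent centred Gaussians of variance `1 / 2`. -/
noncomputable def stdComplexGaussian : Measure ℂ :=
  ((gaussianReal 0 (1 / 2)).prod (gaussianReal 0 (1 / 2))).map Complex.measurableEquivRealProd.symm

/-- A `K`-tier downlink network: the BSs of tier `i` are located at `X i 0, X i 1, …`, and the
link from the BS at `X i n` to the test user has the complex (amplitude) fading coefficient
`h i n`. The tiers are independent Poisson point processes of intensities `lam i`, and the fading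
coefficients are i.i.d. `𝒞𝒩(0,1)` (Rayleigh fading), independent of all locations. -/
structure IsNetwork {Ω : Type*} [MeasurableSpace Ω] (μ : Measure Ω) {K : ℕ}
    (lam : Fin K → ℝ) (X : Fin K → ℕ → Ω → Plane) (h : Fin K → ℕ → Ω → ℂ) : Prop where
  tier_poisson : ∀ i, IsPoissonPointProcess μ (lam i) (X i)
  tier_indep : iIndepFun (fun (i : Fin K) (ω : Ω) => fun n : ℕ => X i n ω) μ
  fading_measurable : ∀ i n, Measurable (h i n)
  fading_law : ∀ i n, μ.map (h i n) = stdComplexGaussian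
  fading_indep : iIndepFun (fun (p : Fin K × ℕ) (ω : Ω) => h p.1 p.2 ω) μ
  fading_indep_location :
    IndepFun (fun (ω : Ω) (i : Fin K) (n : ℕ) => X i n ω)
      (fun (ω : Ω) (i : Fin K) (n : ℕ) => h i n ω) μ

section Model

variable {Ω : Type*} {K : ℕ}

/-- The distance `r_{0,i}` from the test user to the nearest BS of tier `i`. -/
noncomputable def nearestDist (X : Fin K → ℕ → Ω → Plane) (i : Fin K) (ω : Ω) : ℝ :=
  ⨅ n, ‖X i n ω‖

/-- The event that the test user associates with tier `k` under biased received-signal-strength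
association with powers `P`, bias factors `B` and path-loss exponent `4`:
`B_k P_k r_{0,k}^{-4} > B_i P_i r_{0,i}^{-4}` for all `i ≠ k`. -/
def assocEvent (P B : Fin K → ℝ) (X : Fin K → ℕ → Ω → Plane) (k : Fin K) : Set Ω :=
  {ω | ∀ i, i ≠ k →
    B i * P i / nearestDist X i ω ^ 4 < B k * P k / nearestDist X k ω ^ 4}

open Classical in
/-- The interference power that the BS `p = (i, n)` causes at a test user served by the nearest BS
of tier `k`: `P_i |h_{i,n}|² ‖X_{i,n}‖^{-4}`, and `0` if this BS is the serving one. -/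
noncomputable def interferenceTerm (P : Fin K → ℝ) (X : Fin K → ℕ → Ω → Plane)
    (h : Fin K → ℕ → Ω → ℂ) (k : Fin K) (ω : Ω) (p : Fin K × ℕ) : ℝ :=
  if p.1 = k ∧ ‖X p.1 p.2 ω‖ = nearestDist X k ω then 0
  else P p.1 * ‖h p.1 p.2 ω‖ ^ 2 / ‖X p.1 p.2 ω‖ ^ 4

/-- The aggregate interference, from all BSs of all tiers except the serving one, at a test user
served by the nearest BS of tier `k`. -/
noncomputable def interference (P : Fin K → ℝ) (X : Fin K → ℕ → Ω → Plane)
    (h : Fin K → ℕ → Ω → ℂ) (k : Fin K) (ω : Ω) : ℝ :=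
  ∑' p : Fin K × ℕ, interferenceTerm P X h k ω p

variable [MeasurableSpace Ω]

/-- The tier-association probability `𝒜_k`. -/
noncomputable def assocProb (μ : Measure Ω) (P B : Fin K → ℝ) (X : Fin K → ℕ → Ω → Plane)
    (k : Fin K) : ℝ :=
  μ.real (assocEvent P B X k)

/-- The spatially averaged Laplace transform of the aggregate interference for a user of tier `k`,
evaluated at `z = a r_{0,k}^4 / P_k`: the conditional expectation of `exp (-z I)` given that the
test user associates with tier `k`. -/
noncomputable def tierLT (μ : Measure Ω) (P B : Fin K → ℝ) (X : Fin K → ℕ → Ω → Plane)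
    (h : Fin K → ℕ → Ω → ℂ) (a : ℝ) (k : Fin K) : ℝ :=
  ∫ ω, Real.exp (-(a * nearestDist X k ω ^ 4 / P k * interference P X h k ω))
    ∂(ProbabilityTheory.cond μ (assocEvent P B X k))

/-- The averaged Laplace transform of the aggregate interference, over all tiers. -/
noncomputable def averagedLT (μ : Measure Ω) (P B : Fin K → ℝ) (X : Fin K → ℕ → Ω → Plane)
    (h : Fin K → ℕ → Ω → ℂ) (a : ℝ) : ℝ :=
  ∑ k, assocProb μ P B X k * tierLT μ P B X h a k

end Model

end MultiTier

/-! Write $\kappa_i=\sqrt{B_iP_i/(B_kP_k)}$. Given $r_{0,k}^2=s$, association with tier $k$ says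
that tier $i$ has no point with $\|x\|^2<\kappa_i s$. Averaging over Rayleigh fading turns a weight
$w$ into $1/(1+w)$, and the Poisson Laplace functional then gives each tier a factor
$e^{-s\cdot\text{rate}}$. The rate is the void area $\pi\kappa_i$ plus the integral of
$Q/(Q+\|x\|^4)$ outside that disc, times $\lambda_i$; planar scaling makes the exponent exactly
linear in $s$. With $C_k(a)$ the sum of the rates, the Laplace transform restricted to the
association event is $\int_0^\infty \lambda_k\pi e^{-sC_k(a)}\,ds=\lambda_k\pi/C_k(a)$. Taking $a=0$
gives $\mathcal A_k$, and dividing by it gives $\mathcal L^{(k)}$.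

The proof uses neither a density of $r_{0,k}$ nor a Palm distribution. The squared distance is cut
into shells $[jd,jd+d)$. On each shell the integrand is squeezed between two functionals made of
annulus counts, void events and interference from outside the annuli
(`expInterference_le_boundFunctional`, `boundFunctional_le_expInterference`). Their expectations are
explicit, or explicitly bounded, by `IsNetwork.lintegral_prod_void_mul_negExp_mark`. Summing
geometric series and letting $d\to0$ yields `IsNetwork.lintegral_expInterference`. -/

namespace MultiTier

open Filter Topology

/-! ### Exponentials on $[0,\infty]$ and the Poisson generating function. -/

/-- The decreasing exponential `x ↦ exp (-x)` on `[0, ∞]`. -/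
noncomputable def negExp (x : ℝ≥0∞) : ℝ≥0∞ := EReal.exp (-(x : EReal))

@[simp] lemma negExp_zero : negExp 0 = 1 := by simp [negExp]

@[simp] lemma negExp_top : negExp ⊤ = 0 := by simp [negExp]

lemma negExp_ofReal {x : ℝ} (hx : 0 ≤ x) :
    negExp (ENNReal.ofReal x) = ENNReal.ofReal (Real.exp (-x)) := by
  rw [negExp, EReal.coe_ennreal_ofReal, max_eq_left hx, ← EReal.coe_neg, EReal.exp_coe]

lemma negExp_add (x y : ℝ≥0∞) : negExp (x + y) = negExp x * negExp y := by
  rw [negExp, EReal.coe_ennreal_add, EReal.neg_add (by simp) (by simp), sub_eq_add_neg,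
    EReal.exp_add, negExp, negExp]

lemma negExp_antitone : Antitone negExp := fun _ _ hxy ↦
  EReal.exp_monotone (EReal.neg_le_neg_iff.2 (EReal.coe_ennreal_le_coe_ennreal_iff.2 hxy))

lemma negExp_le_one (x : ℝ≥0∞) : negExp x ≤ 1 := by
  simpa using negExp_antitone (zero_le (a := x))

lemma negExp_ne_top (x : ℝ≥0∞) : negExp x ≠ ⊤ :=
  ((negExp_le_one x).trans_lt ENNReal.one_lt_top).ne

lemma continuous_negExp : Continuous negExp :=
  ENNReal.continuous_exp.comp (continuous_neg.comp continuous_coe_ennreal_ereal)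

@[fun_prop]
lemma measurable_negExp : Measurable negExp := continuous_negExp.measurable

lemma negExp_sum {ι : Type*} (s : Finset ι) (f : ι → ℝ≥0∞) :
    negExp (∑ i ∈ s, f i) = ∏ i ∈ s, negExp (f i) := by
  induction s using Finset.cons_induction with
  | empty => simp
  | cons j s hj ih => rw [Finset.sum_cons, Finset.prod_cons, negExp_add, ih]

lemma negExp_nat_mul (n : ℕ) (x : ℝ≥0∞) : negExp (n * x) = negExp x ^ n := by
  simpa using negExp_sum (Finset.range n) (fun _ ↦ x)

/-- The probability generating function of the Poisson distribution. -/
lemma lintegral_pow_poissonMeasure (r : ℝ≥0) {t : ℝ≥0∞} (ht : t ≤ 1) :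
    ∫⁻ n, t ^ n ∂(poissonMeasure r) = negExp (r * (1 - t)) := by
  lift t to ℝ≥0 using (ht.trans_lt ENNReal.one_lt_top).ne
  have ht' : t ≤ 1 := by exact_mod_cast ht
  rw [lintegral_countable']
  simp_rw [poissonMeasure_singleton]
  have h1 : ∀ n : ℕ, (t : ℝ≥0∞) ^ n * ENNReal.ofReal (Real.exp (-r) * r ^ n / n.factorial) =
      ENNReal.ofReal (Real.exp (-r) * ((r * t : ℝ) ^ n / n.factorial)) := fun n ↦ by
    rw [← ENNReal.ofReal_coe_nnreal, ← ENNReal.ofReal_pow (by positivity),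
      ← ENNReal.ofReal_mul (by positivity)]
    congr 1
    rw [mul_pow]; ring
  simp_rw [h1]
  have hs : HasSum (fun n : ℕ ↦ Real.exp (-r) * ((r * t : ℝ) ^ n / n.factorial))
      (Real.exp (-r) * Real.exp (r * t)) := by
    have := NormedSpace.expSeries_div_hasSum_exp (r * t : ℝ)
    rw [← Real.exp_eq_exp_ℝ] at this
    exact this.mul_left _
  rw [← ENNReal.ofReal_tsum_of_nonneg (fun n ↦ by positivity) hs.summable, hs.tsum_eq,
    ← Real.exp_add]
  have : (r : ℝ≥0∞) * (1 - t) = ENNReal.ofReal (r * (1 - t)) := by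
    rw [ENNReal.ofReal_mul (by positivity), ENNReal.ofReal_sub _ (by positivity)]
    simp
  rw [this, negExp_ofReal (mul_nonneg (by positivity) (sub_nonneg.2 (by exact_mod_cast ht')))]
  congr 2
  ring

/-! ### Joint law of the numbers of points in disjoint bounded sets. -/

section Count

lemma toENNReal_count {Ω : Type*} (X : ℕ → Ω → Plane) (A : Set Plane) (ω : Ω) :
    ((count X A ω : ℕ∞) : ℝ≥0∞) = ∑' n, A.indicator (fun _ ↦ 1) (X n ω) := by
  rw [count, ← ENNReal.tsum_set_one, tsum_subtype {n | X n ω ∈ A} (fun _ ↦ (1 : ℝ≥0∞))]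
  rfl

variable {Ω : Type*} [MeasurableSpace Ω] {μ : Measure Ω} {lam : ℝ} {X : ℕ → Ω → Plane}

lemma measurable_count (hX : ∀ n, Measurable (X n)) {A : Set Plane} (hA : MeasurableSet A) :
    Measurable (count X A) := by
  refine measurable_to_countable' fun N ↦ ?_
  have : count X A ⁻¹' {N} =
      (fun ω ↦ ∑' n, A.indicator (fun _ ↦ (1 : ℝ≥0∞)) (X n ω)) ⁻¹' {(N : ℝ≥0∞)} := by
    ext ω
    simp only [Set.mem_preimage, Set.mem_singleton_iff, ← toENNReal_count]
    exact ENat.toENNReal_inj.symm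
  rw [this]
  refine Measurable.tsum (fun n ↦ ?_) (measurableSet_singleton _)
  exact (measurable_const.indicator hA).comp (hX n)

/-- The numbers of points in disjoint bounded sets are independent Poisson variables. -/
lemma IsPoissonPointProcess.lintegral_prod_count [IsProbabilityMeasure μ]
    (hX : IsPoissonPointProcess μ lam X) {ι : Type*} [Fintype ι] {A : ι → Set Plane}
    (hA : ∀ j, MeasurableSet (A j)) (hb : ∀ j, Bornology.IsBounded (A j))
    (hd : Pairwise fun j l ↦ Disjoint (A j) (A l)) (F : ι → ℕ∞ → ℝ≥0∞) :
    ∫⁻ ω, ∏ j, F j (count X (A j) ω) ∂μ =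
      ∏ j, ∫⁻ n : ℕ, F j n ∂(poissonMeasure (lam * (volume (A j)).toReal).toNNReal) := by
  classical
  set ν : ι → Measure ℕ := fun j ↦ poissonMeasure (lam * (volume (A j)).toReal).toNNReal with hν
  set c : Ω → ι → ℕ := fun ω j ↦ (count X (A j) ω).toNat with hc
  have hcm : Measurable c := measurable_pi_lambda _ fun j ↦
    (measurable_of_countable ENat.toNat).comp (measurable_count hX.measurable (hA j))
  set S : (ι → ℕ) → Set Ω := fun N ↦ {ω | ∀ j, count X (A j) ω = (N j : ℕ∞)} with hS
  have hSm : ∀ N, MeasurableSet (S N) := fun N ↦ by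
    simp only [hS, Set.ofPred_forall]
    exact MeasurableSet.iInter fun j ↦
      measurable_count hX.measurable (hA j) (measurableSet_singleton ((N j : ℕ∞)))
  have hSd : Pairwise (Function.onFun Disjoint S) := fun N M hNM ↦ by
    refine Set.disjoint_left.2 fun ω h1 h2 ↦ hNM (funext fun j ↦ ?_)
    exact_mod_cast (h1 j).symm.trans (h2 j)
  have hlaw : ∀ N, μ (S N) = ∏ j, ν j {N j} := fun N ↦ by
    let e := Fintype.equivFin ι
    have := hX.count_law (Fintype.card ι) (fun i ↦ A (e.symm i)) (fun i ↦ hA _) (fun i ↦ hb _)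
      (fun i l hil ↦ hd (e.symm.injective.ne hil)) (fun i ↦ N (e.symm i))
    rw [Equiv.prod_comp e.symm (fun j ↦ ν j {N j})] at this
    rw [← this]
    congr 1
    ext ω
    exact (Equiv.forall_congr_right (q := fun j ↦ count X (A j) ω = (N j : ℕ∞)) e.symm).symm
  -- `count_law` mentions finite values only; since the product Poisson weights sum to one, infinite
  -- counts have probability zero.
  have hsum : μ (⋃ N, S N) = 1 := by
    rw [measure_iUnion hSd hSm]
    simp_rw [hlaw, ← Measure.pi_singleton]
    rw [← Measure.tsum_indicator_apply_singleton (Measure.pi ν) Set.univ MeasurableSet.univ |>.trans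
      measure_univ]
    simp
  have hae : ∀ᵐ ω ∂μ, ω ∈ ⋃ N, S N :=
    (prob_compl_eq_zero_iff (MeasurableSet.iUnion hSm)).2 hsum
  have hcount : ∀ᵐ ω ∂μ, ∀ j, count X (A j) ω = (c ω j : ℕ∞) := by
    filter_upwards [hae] with ω hω j
    obtain ⟨N, hN⟩ := Set.mem_iUnion.1 hω
    simp [hc, hN j]
  have hmap : μ.map c = Measure.pi ν := by
    refine Measure.ext_of_singleton fun N ↦ ?_
    rw [Measure.map_apply hcm (measurableSet_singleton _), Measure.pi_singleton, ← hlaw]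
    refine measure_congr ?_
    filter_upwards [hcount] with ω hω
    refine propext ?_
    change c ω = N ↔ ∀ j, count X (A j) ω = (N j : ℕ∞)
    rw [funext_iff]
    refine forall_congr' fun j ↦ ?_
    rw [hω j]
    exact ENat.natCast_inj.symm
  calc ∫⁻ ω, ∏ j, F j (count X (A j) ω) ∂μ
      = ∫⁻ ω, ∏ j, F j (c ω j) ∂μ := by
        refine lintegral_congr_ae ?_
        filter_upwards [hcount] with ω hω
        simp_rw [hω]
    _ = ∫⁻ N, ∏ j, F j (N j) ∂(Measure.pi ν) := by
        rw [← hmap, lintegral_map (measurable_of_countable _) hcm]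
    _ = ∏ j, ∫⁻ N, F j ((N j : ℕ) : ℕ∞) ∂(Measure.pi ν) := by
        refine lintegral_prod_eq_prod_lintegral_of_indepFun Finset.univ
          (fun j (N : ι → ℕ) ↦ F j (N j)) ?_ (fun j ↦ measurable_of_countable _)
        exact iIndepFun_pi (X := fun j (n : ℕ) ↦ F j n)
          (fun j ↦ (measurable_of_countable _).aemeasurable)
    _ = _ := by
        refine Finset.prod_congr rfl fun j _ ↦ ?_
        have := (measurePreserving_eval ν j).lintegral_comp
          (f := fun n : ℕ ↦ F j n) (measurable_of_countable _)
        exact this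

end Count

/-! ### The Laplace functional of a Poisson process. -/

section Laplace

variable {Ω : Type*} [MeasurableSpace Ω] {μ : Measure Ω} {lam : ℝ} {X : ℕ → Ω → Plane}

/-- The sum of $g$ over the points is $\sum_c c\cdot N(g^{-1}\{c\})$. The nonzero level sets and $A$
are disjoint and bounded, so the expectation factors into Poisson generating functions evaluated at
$e^{-c}$. -/
lemma IsPoissonPointProcess.lintegral_count_mul_negExp_tsum_simpleFunc [IsProbabilityMeasure μ]
    (hX : IsPoissonPointProcess μ lam X) (hlam : 0 ≤ lam) {A : Set Plane} (hA : MeasurableSet A)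
    (hb : Bornology.IsBounded A) (φ : ℕ∞ → ℝ≥0∞) (g : SimpleFunc Plane ℝ≥0∞)
    (hgb : Bornology.IsBounded (Function.support g)) (hgA : ∀ x ∈ A, g x = 0) :
    ∫⁻ ω, φ (count X A ω) * negExp (∑' n, g (X n ω)) ∂μ =
      (∫⁻ n : ℕ, φ n ∂(poissonMeasure (lam * (volume A).toReal).toNNReal)) *
        negExp (ENNReal.ofReal lam * ∫⁻ x, (1 - negExp (g x))) := by
  classical
  set R : Finset ℝ≥0∞ := g.range.filter (· ≠ 0) with hR
  have hR0 : ∀ c ∈ R, c ≠ 0 := fun c hc ↦ (Finset.mem_filter.1 hc).2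
  -- `none` stands for $A$ and `some c` for a level set. The value $0$ is left out because its level
  -- set is unbounded and contains $A$.
  let S : Option R → Set Plane := fun o ↦ o.elim A (fun c ↦ g ⁻¹' {(c : ℝ≥0∞)})
  let F : Option R → ℕ∞ → ℝ≥0∞ := fun o ↦ o.elim φ (fun c k ↦ negExp (c * (k : ℝ≥0∞)))
  have hSm : ∀ o, MeasurableSet (S o) := by
    rintro (_ | c)
    · exact hA
    · exact g.measurableSet_fiber _
  have hSb : ∀ o, Bornology.IsBounded (S o) := by
    rintro (_ | c)
    · exact hb
    · refine hgb.subset fun x hx ↦ ?_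
      rw [Function.mem_support, show g x = c from hx]
      exact hR0 _ c.2
  have hSd : Pairwise fun j l ↦ Disjoint (S j) (S l) := by
    rintro (_ | c) (_ | d) hcd
    · exact absurd rfl hcd
    · exact Set.disjoint_left.2 fun x hx hx' ↦ hR0 _ d.2 ((show g x = d from hx') ▸ hgA x hx)
    · exact Set.disjoint_left.2 fun x hx' hx ↦ hR0 _ c.2 ((show g x = c from hx') ▸ hgA x hx)
    · refine Set.disjoint_left.2 fun x hx hx' ↦ hcd ?_
      exact congrArg some (Subtype.ext ((show g x = c from hx).symm.trans hx'))
  have hsum : ∀ ω, ∑' n, g (X n ω) =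
      ∑ c : R, (c : ℝ≥0∞) * (count X (g ⁻¹' {(c : ℝ≥0∞)}) ω : ℝ≥0∞) := by
    intro ω
    simp_rw [toENNReal_count, ← ENNReal.tsum_mul_left]
    rw [← Summable.tsum_finsetSum (fun _ _ ↦ ENNReal.summable)]
    refine tsum_congr fun n ↦ ?_
    rw [Finset.sum_coe_sort R (fun c ↦ c * (g ⁻¹' {c}).indicator (fun _ ↦ (1 : ℝ≥0∞)) (X n ω))]
    simp only [Set.indicator_apply, Set.mem_preimage, Set.mem_singleton_iff, mul_ite, mul_one,
      mul_zero, Finset.sum_ite_eq]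
    by_cases h0 : g (X n ω) = 0
    · simp [h0]
    · rw [if_pos (Finset.mem_filter.2 ⟨SimpleFunc.mem_range_self _ _, h0⟩)]
  have hvol : ∀ c : R, volume (g ⁻¹' {(c : ℝ≥0∞)}) ≠ ⊤ := fun c ↦
    (hSb (some c)).measure_lt_top.ne
  have hint : ∫⁻ x, (1 - negExp (g x)) =
      ∑ c : R, (1 - negExp c) * volume (g ⁻¹' {(c : ℝ≥0∞)}) := by
    have h1 := (g.map (fun c ↦ 1 - negExp c)).lintegral_eq_lintegral (volume : Measure Plane)
    rw [SimpleFunc.map_lintegral] at h1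
    simp only [SimpleFunc.map_apply] at h1
    rw [h1, Finset.sum_coe_sort R (fun c ↦ (1 - negExp c) * volume (g ⁻¹' {c})), hR,
      Finset.sum_filter]
    refine Finset.sum_congr rfl fun c _ ↦ ?_
    by_cases hc : c = 0 <;> simp [hc]
  have key := hX.lintegral_prod_count hSm hSb hSd F
  simp only [Fintype.prod_option] at key
  have h2 : ∀ ω, φ (count X A ω) * negExp (∑' n, g (X n ω)) =
      F none (count X (S none) ω) * ∏ c : R, F (some c) (count X (S (some c)) ω) := fun ω ↦ by
    rw [hsum, negExp_sum]
    rfl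
  simp_rw [h2]
  rw [key]
  congr 1
  rw [hint, Finset.mul_sum, negExp_sum]
  refine Finset.prod_congr rfl fun c _ ↦ ?_
  have h3 : ∀ n : ℕ, F (some c) n = negExp c ^ n := fun n ↦ by
    rw [← negExp_nat_mul, mul_comm]
    rfl
  simp_rw [h3]
  rw [lintegral_pow_poissonMeasure _ (negExp_le_one _)]
  congr 1
  change ENNReal.ofReal (lam * (volume (g ⁻¹' {(c : ℝ≥0∞)})).toReal) * _ = _
  rw [ENNReal.ofReal_mul hlam, ENNReal.ofReal_toReal (hvol c)]
  ring

lemma tendsto_tsum_of_monotone {ι : Type*} [Countable ι] {f : ℕ → ι → ℝ≥0∞} {F : ι → ℝ≥0∞}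
    (hf : Monotone f) (hF : ∀ i, Tendsto (fun n ↦ f n i) atTop (𝓝 (F i))) :
    Tendsto (fun n ↦ ∑' i, f n i) atTop (𝓝 (∑' i, F i)) := by
  let _ : MeasurableSpace ι := ⊤
  have : MeasurableSingletonClass ι := ⟨fun _ ↦ trivial⟩
  simp_rw [← lintegral_count]
  exact lintegral_tendsto_of_tendsto_of_monotone
    (fun n ↦ (measurable_of_countable _).aemeasurable)
    (ae_of_all _ fun i n m hnm ↦ hf hnm i) (ae_of_all _ hF)

/-- The Laplace functional of a Poisson point process, jointly with the number of points in a set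
that does not contribute to the functional. -/
lemma IsPoissonPointProcess.lintegral_count_mul_negExp_tsum [IsProbabilityMeasure μ]
    (hX : IsPoissonPointProcess μ lam X) (hlam : 0 ≤ lam) {A : Set Plane} (hA : MeasurableSet A)
    (hb : Bornology.IsBounded A) {φ : ℕ∞ → ℝ≥0∞} (hφ : ∀ k, φ k ≤ 1) {g : Plane → ℝ≥0∞}
    (hg : Measurable g) (hgA : ∀ x ∈ A, g x = 0) :
    ∫⁻ ω, φ (count X A ω) * negExp (∑' n, g (X n ω)) ∂μ =
      (∫⁻ n : ℕ, φ n ∂(poissonMeasure (lam * (volume A).toReal).toNNReal)) *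
        negExp (ENNReal.ofReal lam * ∫⁻ x, (1 - negExp (g x))) := by
  -- Restricting to growing balls gives the simple approximations bounded support and keeps them
  -- increasing to $g$.
  let s : ℕ → SimpleFunc Plane ℝ≥0∞ := fun n ↦
    (SimpleFunc.eapprox g n).restrict (Metric.ball 0 n)
  have hs : ∀ n x, s n x = (Metric.ball (0 : Plane) n).indicator (SimpleFunc.eapprox g n) x :=
    fun n x ↦ by rw [SimpleFunc.restrict_apply _ measurableSet_ball]
  have hle : ∀ n x, s n x ≤ g x := fun n x ↦ by
    rw [hs]
    refine (Set.indicator_le_self _ _ _).trans ?_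
    rw [← SimpleFunc.iSup_eapprox_apply hg x]
    exact le_iSup (fun n ↦ SimpleFunc.eapprox g n x) n
  have hmono : Monotone fun n x ↦ s n x := fun n m hnm x ↦ by
    simp only [hs]
    exact (Set.indicator_le_indicator_of_subset (Metric.ball_subset_ball (by exact_mod_cast hnm))
      (fun _ ↦ zero_le) x).trans
      (Set.indicator_le_indicator (SimpleFunc.monotone_eapprox g hnm x))
  have hlim : ∀ x, Tendsto (fun n ↦ s n x) atTop (𝓝 (g x)) := fun x ↦ by
    refine (SimpleFunc.tendsto_eapprox hg x).congr' ?_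
    obtain ⟨N, hN⟩ := exists_nat_gt ‖x‖
    filter_upwards [eventually_ge_atTop N] with n hn
    rw [hs, Set.indicator_of_mem]
    rw [mem_ball_zero_iff]
    exact hN.trans_le (by exact_mod_cast hn)
  have hstep : ∀ n, _ := fun n ↦
    hX.lintegral_count_mul_negExp_tsum_simpleFunc hlam hA hb φ (s n)
      (Metric.isBounded_ball.subset fun x hx ↦ by
        by_contra h
        exact hx ((hs n x).trans (Set.indicator_of_notMem h _)))
      (fun x hx ↦ le_antisymm ((hle n x).trans (hgA x hx).le) zero_le)
  have hL : Tendsto (fun n ↦ ∫⁻ ω, φ (count X A ω) * negExp (∑' m, s n (X m ω)) ∂μ) atTop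
      (𝓝 (∫⁻ ω, φ (count X A ω) * negExp (∑' m, g (X m ω)) ∂μ)) := by
    refine tendsto_lintegral_of_dominated_convergence (fun _ ↦ 1) (fun n ↦ ?_) (fun n ↦ ?_) ?_ ?_
    · refine ((measurable_of_countable φ).comp (measurable_count hX.measurable hA)).mul
        (measurable_negExp.comp (Measurable.tsum fun m ↦ (s n).measurable.comp (hX.measurable m)))
    · exact ae_of_all _ fun ω ↦ mul_le_one' (hφ _) (negExp_le_one _)
    · simp
    · refine ae_of_all _ fun ω ↦ ?_
      refine ENNReal.Tendsto.const_mul ?_ (Or.inr ((hφ _).trans_lt ENNReal.one_lt_top).ne)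
      refine (continuous_negExp.tendsto _).comp (tendsto_tsum_of_monotone ?_ fun m ↦ hlim _)
      exact fun n n' h m ↦ hmono h _
  have hR : Tendsto (fun n ↦
      (∫⁻ n : ℕ, φ n ∂(poissonMeasure (lam * (volume A).toReal).toNNReal)) *
        negExp (ENNReal.ofReal lam * ∫⁻ x, (1 - negExp (s n x)))) atTop
      (𝓝 ((∫⁻ n : ℕ, φ n ∂(poissonMeasure (lam * (volume A).toReal).toNNReal)) *
        negExp (ENNReal.ofReal lam * ∫⁻ x, (1 - negExp (g x))))) := by
    refine ENNReal.Tendsto.const_mul ((continuous_negExp.tendsto _).comp ?_) (Or.inr ?_)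
    · refine ENNReal.Tendsto.const_mul ?_ (Or.inr ENNReal.ofReal_ne_top)
      refine lintegral_tendsto_of_tendsto_of_monotone (fun n ↦ ?_) ?_ ?_
      · exact (measurable_const.sub (measurable_negExp.comp (s n).measurable)).aemeasurable
      · exact ae_of_all _ fun x n m hnm ↦ tsub_le_tsub_left (negExp_antitone (hmono hnm x)) _
      · refine ae_of_all _ fun x ↦ ?_
        exact ENNReal.Tendsto.sub tendsto_const_nhds
          ((continuous_negExp.tendsto _).comp (hlim x)) (Or.inl ENNReal.one_ne_top)
    · refine ((lintegral_mono fun n : ℕ ↦ hφ n).trans_lt ?_).ne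
      simp
  simp_rw [hstep] at hL
  exact tendsto_nhds_unique hL hR

end Laplace

/-! ### Averaging over the fading and over the independent tiers. -/

section Fading

lemma lintegral_exp_neg_sq_gaussianReal {w : ℝ} (hw : 0 ≤ w) :
    ∫⁻ x, ENNReal.ofReal (Real.exp (-(w * x ^ 2))) ∂(gaussianReal 0 (1 / 2)) =
      ENNReal.ofReal (√(1 + w))⁻¹ := by
  rw [← ofReal_integral_eq_lintegral_ofReal]
  · congr 1
    rw [integral_gaussianReal_eq_integral_smul (by simp)]
    simp only [gaussianPDFReal, smul_eq_mul, sub_zero]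
    have h1 : ∀ x : ℝ, (√(2 * Real.pi * ((1 / 2 : ℝ≥0) : ℝ)))⁻¹ *
        Real.exp (-x ^ 2 / (2 * ((1 / 2 : ℝ≥0) : ℝ))) * Real.exp (-(w * x ^ 2)) =
        (√Real.pi)⁻¹ * Real.exp (-(1 + w) * x ^ 2) := fun x ↦ by
      rw [mul_assoc, ← Real.exp_add]
      congr 3
      · push_cast; ring
      · push_cast; ring
    simp_rw [h1]
    rw [integral_const_mul, integral_gaussian, Real.sqrt_div Real.pi_nonneg, div_eq_mul_inv,
      ← mul_assoc, inv_mul_cancel₀ (by positivity), one_mul]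
  · refine Integrable.of_bound (by fun_prop) 1 (ae_of_all _ fun x ↦ ?_)
    rw [Real.norm_of_nonneg (Real.exp_pos _).le, Real.exp_le_one_iff]
    exact neg_nonpos.2 (by positivity)
  · exact ae_of_all _ fun x ↦ (Real.exp_pos _).le

/-- The squared modulus of a `𝒞𝒩(0,1)` variable has the Laplace transform of an exponential
variable of rate `1`. -/
lemma lintegral_negExp_normSq_stdComplexGaussian {w : ℝ} (hw : 0 ≤ w) :
    ∫⁻ z, negExp (ENNReal.ofReal (w * ‖z‖ ^ 2)) ∂stdComplexGaussian =
      negExp (ENNReal.ofReal (Real.log (1 + w))) := by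
  have h1 : ∀ p : ℝ × ℝ,
      negExp (ENNReal.ofReal (w * ‖Complex.measurableEquivRealProd.symm p‖ ^ 2)) =
      ENNReal.ofReal (Real.exp (-(w * p.1 ^ 2))) * ENNReal.ofReal (Real.exp (-(w * p.2 ^ 2))) :=
    fun p ↦ by
      rw [negExp_ofReal (by positivity), ← ENNReal.ofReal_mul (Real.exp_pos _).le, ← Real.exp_add,
        Complex.sq_norm, Complex.normSq_apply]
      congr 2
      simp [Complex.measurableEquivRealProd]
      ring
  rw [stdComplexGaussian, lintegral_map_equiv]
  simp_rw [h1]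
  rw [lintegral_prod_mul (f := fun x ↦ ENNReal.ofReal (Real.exp (-(w * x ^ 2))))
    (g := fun x ↦ ENNReal.ofReal (Real.exp (-(w * x ^ 2)))) (by fun_prop) (by fun_prop),
    lintegral_exp_neg_sq_gaussianReal hw, ← ENNReal.ofReal_mul (by positivity),
    negExp_ofReal (Real.log_nonneg (by linarith)), Real.exp_neg, Real.exp_log (by positivity),
    ← mul_inv, Real.mul_self_sqrt (by positivity)]

variable {Ω : Type*} [MeasurableSpace Ω] {μ : Measure Ω}

/-- Independence handles finite sums; dominated convergence along finite subsets gives the full sum,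
even when it is infinite. Writing $1/(1+w)$ as $e^{-\log(1+w)}$ keeps the result in the form of a
Laplace functional. -/
lemma lintegral_negExp_tsum_fading [IsProbabilityMeasure μ] {ι : Type*} [Countable ι]
    {H : ι → Ω → ℂ} (hm : ∀ p, Measurable (H p)) (hlaw : ∀ p, μ.map (H p) = stdComplexGaussian)
    (hind : iIndepFun H μ) {w : ι → ℝ} (hw : ∀ p, 0 ≤ w p) :
    ∫⁻ ω, negExp (∑' p, ENNReal.ofReal (w p * ‖H p ω‖ ^ 2)) ∂μ =
      negExp (∑' p, ENNReal.ofReal (Real.log (1 + w p))) := by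
  have hfin : ∀ s : Finset ι, ∫⁻ ω, negExp (∑ p ∈ s, ENNReal.ofReal (w p * ‖H p ω‖ ^ 2)) ∂μ =
      negExp (∑ p ∈ s, ENNReal.ofReal (Real.log (1 + w p))) := fun s ↦ by
    simp_rw [negExp_sum]
    have hφ : ∀ p, Measurable fun z : ℂ ↦ negExp (ENNReal.ofReal (w p * ‖z‖ ^ 2)) :=
      fun p ↦ by fun_prop
    rw [lintegral_prod_eq_prod_lintegral_of_indepFun s
      (fun p ω ↦ negExp (ENNReal.ofReal (w p * ‖H p ω‖ ^ 2))) (hind.comp _ hφ)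
      (fun p ↦ (hφ p).comp (hm p))]
    refine Finset.prod_congr rfl fun p _ ↦ ?_
    rw [← lintegral_negExp_normSq_stdComplexGaussian (hw p), ← hlaw p,
      lintegral_map (hφ p) (hm p)]
  have hL : Tendsto (fun s : Finset ι ↦
      ∫⁻ ω, negExp (∑ p ∈ s, ENNReal.ofReal (w p * ‖H p ω‖ ^ 2)) ∂μ) atTop
      (𝓝 (∫⁻ ω, negExp (∑' p, ENNReal.ofReal (w p * ‖H p ω‖ ^ 2)) ∂μ)) := by
    refine tendsto_lintegral_filter_of_dominated_convergence (fun _ ↦ 1)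
      (Eventually.of_forall fun s ↦ ?_) (Eventually.of_forall fun s ↦ ?_) (by simp) ?_
    · have := hm
      fun_prop
    · exact ae_of_all _ fun ω ↦ negExp_le_one _
    · exact ae_of_all _ fun ω ↦ (continuous_negExp.tendsto _).comp ENNReal.summable.hasSum
  simp_rw [hfin] at hL
  exact tendsto_nhds_unique hL ((continuous_negExp.tendsto _).comp ENNReal.summable.hasSum)

variable {K : ℕ} {lam : Fin K → ℝ} {X : Fin K → ℕ → Ω → Plane} {h : Fin K → ℕ → Ω → ℂ}

lemma IsNetwork.measurable_locations (hnet : IsNetwork μ lam X h) :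
    Measurable fun (ω : Ω) (i : Fin K) (n : ℕ) ↦ X i n ω :=
  measurable_pi_lambda _ fun i ↦ measurable_pi_lambda _ fun n ↦ (hnet.tier_poisson i).measurable n

/-- Integrating out the fading coefficients. -/
lemma IsNetwork.lintegral_mul_negExp_fading [IsProbabilityMeasure μ] (hnet : IsNetwork μ lam X h)
    {Z : (Fin K → ℕ → Plane) → ℝ≥0∞} (hZ : Measurable Z) {w : Fin K → Plane → ℝ}
    (hw : ∀ i, Measurable (w i)) (hw0 : ∀ i x, 0 ≤ w i x) :
    ∫⁻ ω, Z (fun i n ↦ X i n ω) *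
        negExp (∑' p : Fin K × ℕ, ENNReal.ofReal (w p.1 (X p.1 p.2 ω) * ‖h p.1 p.2 ω‖ ^ 2)) ∂μ =
      ∫⁻ ω, Z (fun i n ↦ X i n ω) *
        negExp (∑' p : Fin K × ℕ, ENNReal.ofReal (Real.log (1 + w p.1 (X p.1 p.2 ω)))) ∂μ := by
  have hXm := hnet.measurable_locations
  have hhm : Measurable fun (ω : Ω) (i : Fin K) (n : ℕ) ↦ h i n ω :=
    measurable_pi_lambda _ fun i ↦ measurable_pi_lambda _ fun n ↦ hnet.fading_measurable i n
  let Φ : (Fin K → ℕ → Plane) × (Fin K → ℕ → ℂ) → ℝ≥0∞ := fun q ↦ Z q.1 *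
    negExp (∑' p : Fin K × ℕ, ENNReal.ofReal (w p.1 (q.1 p.1 p.2) * ‖q.2 p.1 p.2‖ ^ 2))
  have hΦ : Measurable Φ := by
    refine (hZ.comp measurable_fst).mul (measurable_negExp.comp (Measurable.tsum fun p ↦ ?_))
    have h1 : Measurable fun q : (Fin K → ℕ → Plane) × (Fin K → ℕ → ℂ) ↦ w p.1 (q.1 p.1 p.2) :=
      (hw p.1).comp ((measurable_pi_apply p.2).comp ((measurable_pi_apply p.1).comp measurable_fst))
    have h2 : Measurable fun q : (Fin K → ℕ → Plane) × (Fin K → ℕ → ℂ) ↦ q.2 p.1 p.2 :=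
      (measurable_pi_apply p.2).comp ((measurable_pi_apply p.1).comp measurable_snd)
    fun_prop
  have hjoint := (indepFun_iff_map_prod_eq_prod_map_map hXm.aemeasurable hhm.aemeasurable).1
    hnet.fading_indep_location
  have := Measure.isProbabilityMeasure_map (μ := μ) hhm.aemeasurable
  calc _ = ∫⁻ ω, Φ (fun i n ↦ X i n ω, fun i n ↦ h i n ω) ∂μ := rfl
    _ = ∫⁻ q, Φ q ∂((μ.map fun (ω : Ω) (i : Fin K) (n : ℕ) ↦ X i n ω).prod
          (μ.map fun (ω : Ω) (i : Fin K) (n : ℕ) ↦ h i n ω)) := by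
        rw [← hjoint, lintegral_map hΦ (hXm.prodMk hhm)]
    _ = ∫⁻ ω, ∫⁻ ω', Φ (fun i n ↦ X i n ω, fun i n ↦ h i n ω') ∂μ ∂μ := by
        rw [lintegral_prod _ hΦ.aemeasurable, lintegral_map hΦ.lintegral_prod_right' hXm]
        refine lintegral_congr fun ω ↦ ?_
        exact lintegral_map (hΦ.comp measurable_prodMk_left) hhm
    _ = _ := by
        refine lintegral_congr fun ω ↦ ?_
        simp only [Φ]
        rw [← lintegral_negExp_tsum_fading (H := fun p : Fin K × ℕ ↦ h p.1 p.2)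
            (fun p ↦ hnet.fading_measurable _ _) (fun p ↦ hnet.fading_law _ _) hnet.fading_indep
            (fun p ↦ hw0 _ _)]
        refine lintegral_const_mul _ (measurable_negExp.comp (Measurable.tsum fun p ↦ ?_))
        have := hnet.fading_measurable p.1 p.2
        fun_prop

/-- Integrating over the independent tiers. -/
lemma IsNetwork.lintegral_prod_tier (hnet : IsNetwork μ lam X h)
    {Y : Fin K → (ℕ → Plane) → ℝ≥0∞} (hY : ∀ i, Measurable (Y i)) :
    ∫⁻ ω, ∏ i, Y i (fun n ↦ X i n ω) ∂μ = ∏ i, ∫⁻ ω, Y i (fun n ↦ X i n ω) ∂μ := by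
  refine lintegral_prod_eq_prod_lintegral_of_indepFun Finset.univ
    (fun i ω ↦ Y i (fun n ↦ X i n ω)) (hnet.tier_indep.comp _ hY) fun i ↦ ?_
  exact (hY i).comp (measurable_pi_lambda _ (hnet.tier_poisson i).measurable)

end Fading

/-! ### Area integrals of the path-loss weight. -/

/-- The area integral of `Q / (Q + ‖x‖ ^ 4)` over the region `e ≤ ‖x‖ ^ 2`. -/
noncomputable def tailIntegral (e Q : ℝ) : ℝ :=
  Real.pi * √Q * (Real.pi / 2 - Real.arctan (e / √Q))

lemma tailIntegral_nonneg (e Q : ℝ) : 0 ≤ tailIntegral e Q :=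
  mul_nonneg (by positivity) (sub_nonneg.2 (Real.arctan_lt_pi_div_two _).le)

/-- Scaling of the plane by $\sqrt s$. This homogeneity makes the exponent linear in the squared
serving distance. -/
lemma tailIntegral_mul {s : ℝ} (hs : 0 ≤ s) (e Q : ℝ) :
    tailIntegral (s * e) (s ^ 2 * Q) = s * tailIntegral e Q := by
  rcases hs.eq_or_lt with rfl | hs'
  · simp [tailIntegral]
  · rw [tailIntegral, tailIntegral, Real.sqrt_mul (by positivity), Real.sqrt_sq hs,
      mul_div_mul_left _ _ hs'.ne']
    ring

/-- The integrand is at most $1$ and the annulus removed has area $\pi d$; analytically, $\arctan$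
is $1$-Lipschitz. It bounds the cost of ignoring interferers inside a shell. -/
lemma tailIntegral_le_add {d : ℝ} (hd : 0 ≤ d) (e Q : ℝ) :
    tailIntegral e Q ≤ tailIntegral (e + d) Q + Real.pi * d := by
  rcases (Real.sqrt_nonneg Q).eq_or_lt with h0 | h0
  · simp only [tailIntegral, ← h0]
    have := Real.pi_pos
    simp only [mul_zero, zero_mul, zero_add]
    positivity
  · have h1 : Real.arctan ((e + d) / √Q) - Real.arctan (e / √Q) ≤ d / √Q := by
      have hle : e / √Q ≤ (e + d) / √Q := by gcongr; linarith
      have := image_sub_le_mul_sub_of_deriv_le Real.differentiable_arctan (C := 1) (fun x ↦ by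
        rw [Real.deriv_arctan, div_le_one (by positivity)]
        nlinarith [sq_nonneg x]) hle
      calc _ ≤ 1 * ((e + d) / √Q - e / √Q) := this
        _ = d / √Q := by ring
    have h2 : √Q * (Real.arctan ((e + d) / √Q) - Real.arctan (e / √Q)) ≤ d := by
      calc _ ≤ √Q * (d / √Q) := by gcongr
        _ = d := by field_simp
    have := mul_le_mul_of_nonneg_left h2 Real.pi_nonneg
    simp only [tailIntegral]
    linarith

lemma lintegral_tail {e Q : ℝ} (he : 0 ≤ e) (hQ : 0 ≤ Q) :
    ∫⁻ x : Plane, ENNReal.ofReal (if ‖x‖ ^ 2 < e then 0 else Q / (Q + ‖x‖ ^ 4)) =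
      ENNReal.ofReal (tailIntegral e Q) := by
  rcases hQ.eq_or_lt with rfl | hQ'
  · simp [tailIntegral]
  have hsQ : 0 < √Q := Real.sqrt_pos.2 hQ'
  set f : ℝ → ℝ := fun r ↦ if r ^ 2 < e then 0 else Q / (Q + r ^ 4) with hf
  have hf0 : ∀ r, 0 ≤ f r := fun r ↦ by
    simp only [hf]
    split_ifs <;> positivity
  -- An antiderivative of the radial integrand, the factor $r$ being the Jacobian of polar
  -- coordinates.
  let G : ℝ → ℝ := fun r ↦ √Q / 2 * Real.arctan (r ^ 2 / √Q)
  have hderiv : ∀ r ∈ Set.Ici (√e), HasDerivAt G (r * (Q / (Q + r ^ 4))) r := fun r _ ↦ by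
    have h1 : HasDerivAt (fun r : ℝ ↦ r ^ 2 / √Q) (2 * r / √Q) r := by
      simpa using (hasDerivAt_pow 2 r).div_const (√Q)
    refine (h1.arctan.const_mul (√Q / 2)).congr_deriv ?_
    have : (√Q) ^ 2 = Q := Real.sq_sqrt hQ
    have h3 : (1 : ℝ) + (r ^ 2 / √Q) ^ 2 = (Q + r ^ 4) / Q := by
      rw [div_pow, this]; field_simp
    rw [h3]
    have : 0 < Q + r ^ 4 := by positivity
    field_simp
  have hlim : Tendsto G atTop (𝓝 (√Q / 2 * (Real.pi / 2))) := by
    refine Tendsto.const_mul _ ((tendsto_nhds_of_tendsto_nhdsWithin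
      Real.tendsto_arctan_atTop).comp ?_)
    exact (tendsto_pow_atTop two_ne_zero).atTop_div_const hsQ
  have hpos : ∀ r ∈ Set.Ioi (√e), 0 ≤ r * (Q / (Q + r ^ 4)) := fun r hr ↦ by
    have : 0 < r := (Real.sqrt_nonneg e).trans_lt hr
    positivity
  have hint := integrableOn_Ioi_deriv_of_nonneg' hderiv hpos hlim
  have hval := integral_Ioi_of_hasDerivAt_of_nonneg' hderiv hpos hlim
  have hind : Set.EqOn (fun r ↦ r ^ (Module.finrank ℝ Plane - 1) • f r)
      ((Set.Ici (√e)).indicator fun r ↦ r * (Q / (Q + r ^ 4))) (Set.Ioi 0) := fun r hr ↦ by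
    have hr' : 0 < r := hr
    by_cases h : √e ≤ r
    · rw [Set.indicator_of_mem (Set.mem_Ici.2 h)]
      simp [hf, not_lt.2 ((Real.sqrt_le_left hr'.le).1 h)]
    · rw [Set.indicator_of_notMem (by simpa using h)]
      simp [hf, (Real.lt_sqrt hr'.le).1 (not_le.1 h)]
  have hsub : ∀ᵐ r ∂(volume.restrict (Set.Ioi (0 : ℝ))), (Set.Ici (√e)).indicator
      (fun r ↦ r * (Q / (Q + r ^ 4))) r = (Set.Ioi (√e)).indicator
      (fun r ↦ r * (Q / (Q + r ^ 4))) r :=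
    ae_restrict_of_ae (indicator_ae_eq_of_ae_eq_set Ioi_ae_eq_Ici.symm)
  have hss : Set.Ioi (0 : ℝ) ∩ Set.Ioi (√e) = Set.Ioi (√e) :=
    Set.inter_eq_right.2 (Set.Ioi_subset_Ioi (Real.sqrt_nonneg e))
  have hi : Integrable (fun x : Plane ↦ f ‖x‖) := by
    rw [integrable_fun_norm_addHaar, integrableOn_congr_fun hind measurableSet_Ioi, IntegrableOn,
      integrable_congr hsub, ← IntegrableOn, integrableOn_indicator_iff measurableSet_Ioi,
      Set.inter_comm, hss]
    exact hint
  change ∫⁻ x : Plane, ENNReal.ofReal (f ‖x‖) = _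
  rw [← ofReal_integral_eq_lintegral_ofReal hi (ae_of_all _ fun x ↦ hf0 _),
    integral_fun_norm_addHaar, setIntegral_congr_fun measurableSet_Ioi hind,
    integral_congr_ae hsub, setIntegral_indicator measurableSet_Ioi, hss, hval, measureReal_def,
    EuclideanSpace.volume_ball_fin_two]
  congr 1
  simp only [G, Real.sq_sqrt he, tailIntegral, finrank_euclideanSpace, Fintype.card_fin]
  simp [Real.pi_nonneg]
  ring

/-- The annulus `b ≤ ‖x‖ ^ 2 < e`. -/
def annulus (b e : ℝ) : Set Plane := {x | b ≤ ‖x‖ ^ 2 ∧ ‖x‖ ^ 2 < e}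

/-- Charges an infinite cost to the points with `‖x‖ ^ 2 < b`. -/
noncomputable def voidCost (b : ℝ) (x : Plane) : ℝ≥0∞ := if ‖x‖ ^ 2 < b then ⊤ else 0

/-- The path-loss weight `Q / ‖x‖ ^ 4`, restricted to the points with `e ≤ ‖x‖ ^ 2`. -/
noncomputable def markWeight (e Q : ℝ) (x : Plane) : ℝ := if ‖x‖ ^ 2 < e then 0 else Q / ‖x‖ ^ 4

lemma measurableSet_normSq_lt (b : ℝ) : MeasurableSet {x : Plane | ‖x‖ ^ 2 < b} :=
  measurableSet_lt (by fun_prop) measurable_const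

lemma measurableSet_annulus (b e : ℝ) : MeasurableSet (annulus b e) :=
  (measurableSet_le (f := fun _ : Plane ↦ b) (g := fun x : Plane ↦ ‖x‖ ^ 2) measurable_const
    (by fun_prop)).inter (measurableSet_normSq_lt e)

@[fun_prop]
lemma measurable_voidCost (b : ℝ) : Measurable (voidCost b) :=
  Measurable.ite (measurableSet_normSq_lt b) measurable_const measurable_const

@[fun_prop]
lemma measurable_markWeight (e Q : ℝ) : Measurable (markWeight e Q) :=
  Measurable.ite (measurableSet_normSq_lt e) measurable_const (by fun_prop)

lemma markWeight_nonneg {Q : ℝ} (hQ : 0 ≤ Q) (e : ℝ) (x : Plane) : 0 ≤ markWeight e Q x := by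
  unfold markWeight
  split_ifs <;> positivity

lemma setOf_normSq_lt (b : ℝ) : {x : Plane | ‖x‖ ^ 2 < b} = Metric.ball 0 (√b) := by
  ext x
  rw [mem_ball_zero_iff]
  exact (Real.lt_sqrt (norm_nonneg x)).symm

lemma volume_normSq_lt {b : ℝ} (hb : 0 ≤ b) :
    volume {x : Plane | ‖x‖ ^ 2 < b} = ENNReal.ofReal (Real.pi * b) := by
  rw [setOf_normSq_lt, EuclideanSpace.volume_ball_fin_two, ← ENNReal.ofReal_pow (by positivity),
    Real.sq_sqrt hb, mul_comm, ENNReal.ofReal_mul Real.pi_nonneg]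

lemma isBounded_annulus (b e : ℝ) : Bornology.IsBounded (annulus b e) := by
  refine (Metric.isBounded_ball (x := (0 : Plane)) (r := √e)).subset fun x hx ↦ ?_
  rw [mem_ball_zero_iff]
  exact (Real.lt_sqrt (norm_nonneg x)).2 hx.2

lemma volume_annulus {b e : ℝ} (hb : 0 ≤ b) (hbe : b ≤ e) :
    volume (annulus b e) = ENNReal.ofReal (Real.pi * (e - b)) := by
  have h : annulus b e = {x : Plane | ‖x‖ ^ 2 < e} \ {x : Plane | ‖x‖ ^ 2 < b} := by
    ext x
    simp only [annulus, Set.mem_ofPred_eq, Set.mem_sdiff, not_lt]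
    exact and_comm
  rw [h, measure_sdiff (s₁ := {x : Plane | ‖x‖ ^ 2 < e}) (s₂ := {x : Plane | ‖x‖ ^ 2 < b})
    (fun x (hx : ‖x‖ ^ 2 < b) ↦ hx.trans_le hbe) (measurableSet_normSq_lt b).nullMeasurableSet
    (by rw [volume_normSq_lt hb]; simp),
    volume_normSq_lt hb, volume_normSq_lt (hb.trans hbe), ← ENNReal.ofReal_sub _ (by positivity)]
  congr 1
  ring

/-- Points of the void disc have infinite cost and contribute $1$ each, hence the area $\pi b$;
beyond $e$ the integrand is $1-1/(1+Q/\|x\|^4)=Q/(Q+\|x\|^4)$. -/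
lemma lintegral_one_sub_negExp {b e Q : ℝ} (hb : 0 ≤ b) (hbe : b ≤ e) (hQ : 0 ≤ Q) :
    ∫⁻ x : Plane, (1 - negExp (voidCost b x + ENNReal.ofReal (Real.log (1 + markWeight e Q x)))) =
      ENNReal.ofReal (Real.pi * b + tailIntegral e Q) := by
  rw [ENNReal.ofReal_add (by positivity) (tailIntegral_nonneg _ _), ← volume_normSq_lt hb,
    ← lintegral_tail (hb.trans hbe) hQ, ← lintegral_indicator_one (measurableSet_normSq_lt b),
    ← lintegral_add_left (measurable_one.indicator (measurableSet_normSq_lt b))]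
  refine lintegral_congr_ae ?_
  -- The origin is discarded: there `Q / ‖x‖ ^ 4` is `0` by convention, while `Q / (Q + ‖x‖ ^ 4)` is
  -- `1` for positive `Q`.
  filter_upwards [compl_mem_ae_iff.2 (measure_singleton (μ := volume) (0 : Plane))] with x hx
  have hx0 : 0 < ‖x‖ := norm_pos_iff.2 hx
  by_cases h1 : ‖x‖ ^ 2 < b
  · simp [voidCost, h1, h1.trans_le hbe]
  by_cases h2 : ‖x‖ ^ 2 < e
  · simp [voidCost, markWeight, h1, h2]
  · have h3 : (0 : ℝ) ≤ Q / ‖x‖ ^ 4 := by positivity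
    simp only [voidCost, markWeight, h1, h2, if_false, zero_add, Set.indicator_apply,
      Set.mem_ofPred_eq]
    rw [negExp_ofReal (Real.log_nonneg (by linarith)), Real.exp_neg, Real.exp_log (by positivity),
      ← ENNReal.ofReal_one, ← ENNReal.ofReal_sub _ (by positivity)]
    congr 1
    field_simp
    ring

/-! ### Expectation of products of counts, voids and exterior interference. -/

section Network

variable {Ω : Type*} [MeasurableSpace Ω] {μ : Measure Ω}
variable {K : ℕ} {lam : Fin K → ℝ} {X : Fin K → ℕ → Ω → Plane} {h : Fin K → ℕ → Ω → ℂ}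

lemma IsNetwork.lintegral_prod_void_mul_negExp_mark [IsProbabilityMeasure μ]
    (hnet : IsNetwork μ lam X h) (hlam : ∀ i, 0 ≤ lam i) {b e Q : Fin K → ℝ} (hb : ∀ i, 0 ≤ b i)
    (hbe : ∀ i, b i ≤ e i) (hQ : ∀ i, 0 ≤ Q i) {φ : Fin K → ℕ∞ → ℝ≥0∞} (hφ : ∀ i k, φ i k ≤ 1) :
    ∫⁻ ω, (∏ i, φ i (count (X i) (annulus (b i) (e i)) ω) *
          negExp (∑' n, voidCost (b i) (X i n ω))) *
        negExp (∑' p : Fin K × ℕ, ENNReal.ofReal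
          (markWeight (e p.1) (Q p.1) (X p.1 p.2 ω) * ‖h p.1 p.2 ω‖ ^ 2)) ∂μ =
      ∏ i, (∫⁻ n : ℕ, φ i n ∂(poissonMeasure (lam i * (Real.pi * (e i - b i))).toNNReal)) *
        negExp (ENNReal.ofReal (lam i * (Real.pi * b i + tailIntegral (e i) (Q i)))) := by
  have hcount : ∀ i, Measurable fun x : ℕ → Plane ↦
      φ i (count (fun n (x : ℕ → Plane) ↦ x n) (annulus (b i) (e i)) x) := fun i ↦
    (measurable_of_countable (φ i)).comp
      (measurable_count (fun n ↦ measurable_pi_apply n) (measurableSet_annulus _ _))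
  have hvoid : ∀ i, Measurable fun x : ℕ → Plane ↦ negExp (∑' n, voidCost (b i) (x n)) := fun i ↦
    measurable_negExp.comp (Measurable.tsum fun n ↦
      (measurable_voidCost _).comp (measurable_pi_apply n))
  refine (hnet.lintegral_mul_negExp_fading
    (Z := fun x ↦ ∏ i, φ i (count (fun n (x : ℕ → Plane) ↦ x n) (annulus (b i) (e i)) (x i)) *
      negExp (∑' n, voidCost (b i) (x i n)))
    (Finset.measurable_prod _ fun i _ ↦ ((hcount i).mul (hvoid i)).comp (measurable_pi_apply i))
    (w := fun i ↦ markWeight (e i) (Q i)) (fun i ↦ measurable_markWeight _ _)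
    (fun i x ↦ markWeight_nonneg (hQ i) _ _)).trans ?_
  have h1 : ∀ ω, (∏ i, φ i (count (X i) (annulus (b i) (e i)) ω) *
        negExp (∑' n, voidCost (b i) (X i n ω))) *
      negExp (∑' p : Fin K × ℕ, ENNReal.ofReal
        (Real.log (1 + markWeight (e p.1) (Q p.1) (X p.1 p.2 ω)))) =
      ∏ i, φ i (count (X i) (annulus (b i) (e i)) ω) * negExp (∑' n, (voidCost (b i) (X i n ω) +
        ENNReal.ofReal (Real.log (1 + markWeight (e i) (Q i) (X i n ω))))) := fun ω ↦ by
    rw [ENNReal.tsum_prod (f := fun i n ↦ ENNReal.ofReal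
      (Real.log (1 + markWeight (e i) (Q i) (X i n ω)))), tsum_fintype, negExp_sum,
      ← Finset.prod_mul_distrib]
    refine Finset.prod_congr rfl fun i _ ↦ ?_
    rw [ENNReal.tsum_add, negExp_add, mul_assoc]
  refine (lintegral_congr h1).trans ?_
  refine (hnet.lintegral_prod_tier (Y := fun i x ↦
    φ i (count (fun n (x : ℕ → Plane) ↦ x n) (annulus (b i) (e i)) x) *
      negExp (∑' n, (voidCost (b i) (x n) +
        ENNReal.ofReal (Real.log (1 + markWeight (e i) (Q i) (x n))))))
    (fun i ↦ (hcount i).mul (measurable_negExp.comp (Measurable.tsum fun n ↦ by fun_prop)))).trans ?_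
  refine Finset.prod_congr rfl fun i _ ↦ ?_
  -- Void cost and marks both vanish on the annulus, so its count is independent of the exponential
  -- factor.
  have h2 := (hnet.tier_poisson i).lintegral_count_mul_negExp_tsum (hlam i)
    (measurableSet_annulus (b i) (e i)) (isBounded_annulus _ _) (hφ i)
    (g := fun x ↦ voidCost (b i) x + ENNReal.ofReal (Real.log (1 + markWeight (e i) (Q i) x)))
    (by fun_prop) (fun x hx ↦ by simp [voidCost, markWeight, hx.2, not_lt.2 hx.1])
  rw [lintegral_one_sub_negExp (hb i) (hbe i) (hQ i), volume_annulus (hb i) (hbe i),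
    ENNReal.toReal_ofReal (mul_nonneg Real.pi_nonneg (sub_nonneg.2 (hbe i))),
    ← ENNReal.ofReal_mul (hlam i)] at h2
  exact h2

end Network

/-! ### Pathwise bounds on a shell of the serving distance. -/

section Pathwise

variable {Ω : Type*} {K : ℕ} {P B : Fin K → ℝ} {X : Fin K → ℕ → Ω → Plane} {h : Fin K → ℕ → Ω → ℂ}

lemma nearestDist_nonneg (X : Fin K → ℕ → Ω → Plane) (i : Fin K) (ω : Ω) :
    0 ≤ nearestDist X i ω :=
  Real.iInf_nonneg fun _ ↦ norm_nonneg _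

lemma nearestDist_le (X : Fin K → ℕ → Ω → Plane) (i : Fin K) (n : ℕ) (ω : Ω) :
    nearestDist X i ω ≤ ‖X i n ω‖ :=
  ciInf_le ⟨0, by rintro _ ⟨m, rfl⟩; exact norm_nonneg _⟩ n

lemma nearestDist_sq_le (X : Fin K → ℕ → Ω → Plane) (i : Fin K) (n : ℕ) (ω : Ω) :
    nearestDist X i ω ^ 2 ≤ ‖X i n ω‖ ^ 2 :=
  pow_le_pow_left₀ (nearestDist_nonneg X i ω) (nearestDist_le X i n ω) 2

lemma le_nearestDist_sq {b : ℝ} {i : Fin K} {ω : Ω} (hb : ∀ n, b ≤ ‖X i n ω‖ ^ 2) :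
    b ≤ nearestDist X i ω ^ 2 :=
  Real.sqrt_le_left (nearestDist_nonneg X i ω) |>.1
    (le_ciInf fun n ↦ (Real.sqrt_le_left (norm_nonneg _)).2 (hb n))

lemma exists_normSq_lt_of_nearestDist_sq_lt {b : ℝ} {i : Fin K} {ω : Ω}
    (hb : nearestDist X i ω ^ 2 < b) : ∃ n, ‖X i n ω‖ ^ 2 < b := by
  by_contra! hcon
  exact absurd (le_nearestDist_sq hcon) (not_le.2 hb)

lemma interferenceTerm_nonneg (hP : ∀ i, 0 ≤ P i) (k : Fin K) (ω : Ω) (p : Fin K × ℕ) :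
    0 ≤ interferenceTerm P X h k ω p := by
  unfold interferenceTerm
  have := hP p.1
  split_ifs <;> positivity

lemma interferenceTerm_le (hP : ∀ i, 0 ≤ P i) (k : Fin K) (ω : Ω) (p : Fin K × ℕ) :
    interferenceTerm P X h k ω p ≤ P p.1 * ‖h p.1 p.2 ω‖ ^ 2 / ‖X p.1 p.2 ω‖ ^ 4 := by
  unfold interferenceTerm
  have := hP p.1
  split_ifs
  · positivity
  · rfl

lemma count_ne_zero_iff {Y : ℕ → Ω → Plane} {A : Set Plane} {ω : Ω} :
    count Y A ω ≠ 0 ↔ ∃ n, Y n ω ∈ A := by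
  rw [count, Set.encard_ne_zero]
  rfl

lemma count_eq_one_iff {Y : ℕ → Ω → Plane} {A : Set Plane} {ω : Ω} :
    count Y A ω = 1 ↔ ∃ n, ∀ m, Y m ω ∈ A ↔ m = n := by
  rw [count, Set.encard_eq_one]
  refine exists_congr fun n ↦ ?_
  rw [Set.ext_iff]
  rfl

lemma negExp_tsum_voidCost_eq_one {b : ℝ} {Y : ℕ → Plane} (hY : ∀ n, b ≤ ‖Y n‖ ^ 2) :
    negExp (∑' n, voidCost b (Y n)) = 1 := by
  simp [voidCost, fun n ↦ not_lt.2 (hY n)]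

lemma negExp_tsum_voidCost_eq_zero {b : ℝ} {Y : ℕ → Plane} {n : ℕ} (hY : ‖Y n‖ ^ 2 < b) :
    negExp (∑' n, voidCost b (Y n)) = 0 := by
  rw [ENNReal.tsum_eq_top_of_eq_top ⟨n, by simp [voidCost, hY]⟩, negExp_top]

/-- The ratio between the squared distances at which tiers `i` and `k` are equally attractive. -/
noncomputable def sqDistRatio (P B : Fin K → ℝ) (k i : Fin K) : ℝ := √(B i * P i / (B k * P k))

lemma sqDistRatio_pos (hP : ∀ i, 0 < P i) (hB : ∀ i, 0 < B i) (k i : Fin K) :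
    0 < sqDistRatio P B k i :=
  Real.sqrt_pos.2 (div_pos (mul_pos (hB i) (hP i)) (mul_pos (hB k) (hP k)))

lemma sqDistRatio_self (hP : ∀ i, 0 < P i) (hB : ∀ i, 0 < B i) (k : Fin K) :
    sqDistRatio P B k k = 1 := by
  rw [sqDistRatio, div_self (mul_pos (hB k) (hP k)).ne', Real.sqrt_one]

lemma biased_power_lt_iff (hP : ∀ i, 0 < P i) (hB : ∀ i, 0 < B i) {k i : Fin K} {r t : ℝ}
    (hr : 0 < r) (ht : 0 < t) :
    B i * P i / t ^ 4 < B k * P k / r ^ 4 ↔ sqDistRatio P B k i * r ^ 2 < t ^ 2 := by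
  have hk : 0 < B k * P k := mul_pos (hB k) (hP k)
  have hi : 0 < B i * P i := mul_pos (hB i) (hP i)
  rw [← pow_lt_pow_iff_left₀ (mul_pos (sqDistRatio_pos hP hB k i) (by positivity)).le
    (by positivity) two_ne_zero, mul_pow, sqDistRatio, Real.sq_sqrt (by positivity),
    div_lt_div_iff₀ (by positivity) (by positivity), div_mul_eq_mul_div, div_lt_iff₀ hk]
  ring_nf

/-- The exponential of the normalized interference, as an extended nonnegative number. -/
noncomputable def expInterference (P : Fin K → ℝ) (X : Fin K → ℕ → Ω → Plane)
    (h : Fin K → ℕ → Ω → ℂ) (a : ℝ) (k : Fin K) (ω : Ω) : ℝ≥0∞ :=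
  negExp (∑' p, ENNReal.ofReal (a * nearestDist X k ω ^ 4 / P k * interferenceTerm P X h k ω p))

lemma toReal_expInterference (hP : ∀ i, 0 < P i) {a : ℝ} (ha : 0 ≤ a) {k : Fin K} {ω : Ω}
    (hω : Summable (interferenceTerm P X h k ω)) :
    (expInterference P X h a k ω).toReal =
      Real.exp (-(a * nearestDist X k ω ^ 4 / P k * interference P X h k ω)) := by
  have hc : 0 ≤ a * nearestDist X k ω ^ 4 / P k :=
    div_nonneg (mul_nonneg ha (pow_nonneg (nearestDist_nonneg X k ω) 4)) (hP k).le
  have hn := interferenceTerm_nonneg (X := X) (h := h) (fun i ↦ (hP i).le) k ω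
  rw [expInterference, ← ENNReal.ofReal_tsum_of_nonneg (fun p ↦ mul_nonneg hc (hn p))
    (hω.mul_left _), tsum_mul_left, negExp_ofReal (mul_nonneg hc (tsum_nonneg hn)),
    ENNReal.toReal_ofReal (Real.exp_pos _).le, interference]

/-- The functional of the network that the lower and upper bounds are made of: the product of
functions of the numbers of points in annuli, of void events, and of the exponential of the
interference from outside the annuli. -/
noncomputable def boundFunctional (X : Fin K → ℕ → Ω → Plane) (h : Fin K → ℕ → Ω → ℂ)
    (b e Q : Fin K → ℝ) (φ : Fin K → ℕ∞ → ℝ≥0∞) (ω : Ω) : ℝ≥0∞ :=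
  (∏ i, φ i (count (X i) (annulus (b i) (e i)) ω) * negExp (∑' n, voidCost (b i) (X i n ω))) *
    negExp (∑' p : Fin K × ℕ, ENNReal.ofReal
      (markWeight (e p.1) (Q p.1) (X p.1 p.2 ω) * ‖h p.1 p.2 ω‖ ^ 2))

/-- The event that the squared distance to the nearest point of tier `k` lies in `[s, t)`. -/
def shellEvent (X : Fin K → ℕ → Ω → Plane) (k : Fin K) (s t : ℝ) : Set Ω :=
  {ω | s ≤ nearestDist X k ω ^ 2 ∧ nearestDist X k ω ^ 2 < t}

lemma iUnion_shellEvent {d : ℝ} (hd : 0 < d) (k : Fin K) :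
    ⋃ j : ℕ, shellEvent X k (j * d) (j * d + d) = Set.univ := by
  refine Set.eq_univ_of_forall fun ω ↦ Set.mem_iUnion.2 ⟨⌊nearestDist X k ω ^ 2 / d⌋₊, ?_, ?_⟩
  · have := Nat.floor_le (a := nearestDist X k ω ^ 2 / d) (by positivity)
    exact (le_div_iff₀ hd).1 this
  · have := (div_lt_iff₀ hd).1 (Nat.lt_floor_add_one (nearestDist X k ω ^ 2 / d))
    linarith

lemma pairwise_disjoint_shellEvent {d : ℝ} (hd : 0 < d) (k : Fin K) :
    Pairwise (Function.onFun Disjoint fun j : ℕ ↦ shellEvent X k (j * d) (j * d + d)) := by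
  intro i j hij
  refine Set.disjoint_left.2 fun ω ⟨h1, h2⟩ ⟨h3, h4⟩ ↦ hij ?_
  have h5 : (i : ℝ) * d < (j + 1) * d := by linarith
  have h6 : (j : ℝ) * d < (i + 1) * d := by linarith
  have h7 : (i : ℝ) < j + 1 := lt_of_mul_lt_mul_right h5 hd.le
  have h8 : (j : ℝ) < i + 1 := lt_of_mul_lt_mul_right h6 hd.le
  norm_cast at h7 h8
  omega

/-- On the shell, tier $k$ has a point in the annulus and every tier respects its void at level $s$.
Dropping the tier-$k$ points with squared norm below $t$ and lowering $r_{0,k}^2$ to $s$ only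
decreases the interference. -/
lemma expInterference_le_boundFunctional (hP : ∀ i, 0 < P i) (hB : ∀ i, 0 < B i) {a : ℝ}
    (ha : 0 ≤ a) {k : Fin K} {s t : ℝ} (hs : 0 ≤ s) {ω : Ω}
    (hpos : ∀ i, 0 < nearestDist X i ω) (hω : ω ∈ shellEvent X k s t)
    (hA : ω ∈ assocEvent P B X k) :
    expInterference P X h a k ω ≤ boundFunctional X h (fun i ↦ s * sqDistRatio P B k i)
      (fun i ↦ if i = k then t else s * sqDistRatio P B k i) (fun i ↦ s ^ 2 * (a * P i / P k))
      (fun i n ↦ if i = k then if n = 0 then 0 else 1 else 1) ω := by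
  obtain ⟨hst, htt⟩ := hω
  have hvoid : ∀ i n, s * sqDistRatio P B k i ≤ ‖X i n ω‖ ^ 2 := fun i n ↦ by
    refine le_trans ?_ (nearestDist_sq_le X i n ω)
    by_cases hik : i = k
    · subst hik
      rwa [sqDistRatio_self hP hB, mul_one]
    · have := (biased_power_lt_iff hP hB (hpos k) (hpos i)).1 (hA i hik)
      nlinarith [sqDistRatio_pos hP hB k i]
  have hone : (∏ i, (if i = k then if count (X i) (annulus (s * sqDistRatio P B k i)
        (if i = k then t else s * sqDistRatio P B k i)) ω = 0 then (0 : ℝ≥0∞) else 1 else 1) *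
      negExp (∑' n, voidCost (s * sqDistRatio P B k i) (X i n ω))) = 1 := by
    refine Finset.prod_eq_one fun i _ ↦ ?_
    rw [negExp_tsum_voidCost_eq_one (hvoid i), mul_one]
    by_cases hik : i = k
    · subst hik
      obtain ⟨n, hn⟩ := exists_normSq_lt_of_nearestDist_sq_lt htt
      rw [if_pos rfl, if_neg]
      refine count_ne_zero_iff.2 ⟨n, hvoid i n, ?_⟩
      rwa [if_pos rfl]
    · rw [if_neg hik]
  rw [boundFunctional, hone, one_mul]
  refine negExp_antitone (ENNReal.tsum_le_tsum fun p ↦ ENNReal.ofReal_le_ofReal ?_)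
  have hPk := hP k
  have hPi := hP p.1
  have hr := hpos k
  have h0 : 0 ≤ a * nearestDist X k ω ^ 4 / P k * interferenceTerm P X h k ω p :=
    mul_nonneg (by positivity) (interferenceTerm_nonneg (fun i ↦ (hP i).le) k ω p)
  by_cases h1 : ‖X p.1 p.2 ω‖ ^ 2 < if p.1 = k then t else s * sqDistRatio P B k p.1
  · rw [markWeight, if_pos h1, zero_mul]
    exact h0
  · rw [markWeight, if_neg h1, interferenceTerm, if_neg]
    · calc _ = s ^ 2 * (a * P p.1 / P k * ‖h p.1 p.2 ω‖ ^ 2 / ‖X p.1 p.2 ω‖ ^ 4) := by ring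
        _ ≤ (nearestDist X k ω ^ 2) ^ 2 *
            (a * P p.1 / P k * ‖h p.1 p.2 ω‖ ^ 2 / ‖X p.1 p.2 ω‖ ^ 4) := by gcongr
        _ = _ := by ring
    -- A serving point lies inside the annulus, so it never reaches this branch.
    · rintro ⟨h2, h3⟩
      rw [if_pos h2, h3] at h1
      exact h1 htt

lemma boundFunctional_eq_zero {b e Q : Fin K → ℝ} {φ : Fin K → ℕ∞ → ℝ≥0∞} {ω : Ω} (i : Fin K)
    (hi : φ i (count (X i) (annulus (b i) (e i)) ω) = 0 ∨
      negExp (∑' n, voidCost (b i) (X i n ω)) = 0) :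
    boundFunctional X h b e Q φ ω = 0 := by
  rw [boundFunctional]
  refine mul_eq_zero_of_left (Finset.prod_eq_zero (Finset.mem_univ i) ?_) _
  exact mul_eq_zero.2 hi

lemma boundFunctional_le {b e Q : Fin K → ℝ} {φ : Fin K → ℕ∞ → ℝ≥0∞} (hφ : ∀ i n, φ i n ≤ 1)
    (ω : Ω) : boundFunctional X h b e Q φ ω ≤ negExp (∑' p : Fin K × ℕ, ENNReal.ofReal
      (markWeight (e p.1) (Q p.1) (X p.1 p.2 ω) * ‖h p.1 p.2 ω‖ ^ 2)) :=
  mul_le_of_le_one_left zero_le (Finset.prod_le_one' fun _ _ ↦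
    mul_le_one' (hφ _ _) (negExp_le_one _))

/-- If tier $k$ has exactly one point in the annulus and none closer, that point serves and all
other points of the tier lie beyond $t$. Voids at level $t$ in the other tiers force association,
and raising $r_{0,k}^2$ to $t$ only increases the interference. -/
lemma boundFunctional_le_expInterference (hP : ∀ i, 0 < P i) (hB : ∀ i, 0 < B i) {a : ℝ}
    (ha : 0 ≤ a) {k : Fin K} {s t : ℝ} (ht : 0 < t) {ω : Ω} (hpos : 0 < nearestDist X k ω) :
    boundFunctional X h (fun i ↦ if i = k then s else t * sqDistRatio P B k i)
      (fun i ↦ t * sqDistRatio P B k i) (fun i ↦ t ^ 2 * (a * P i / P k))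
      (fun i n ↦ if i = k then if n = 1 then 1 else 0 else 1) ω ≤
    (assocEvent P B X k ∩ shellEvent X k s t).indicator (expInterference P X h a k) ω := by
  by_cases hvoid : ∀ i n, (if i = k then s else t * sqDistRatio P B k i) ≤ ‖X i n ω‖ ^ 2
  swap
  · push Not at hvoid
    obtain ⟨i, n, hin⟩ := hvoid
    rw [boundFunctional_eq_zero i (Or.inr (negExp_tsum_voidCost_eq_zero hin))]
    exact zero_le
  by_cases hc : count (X k) (annulus s t) ω = 1
  swap
  · rw [boundFunctional_eq_zero k (Or.inl (by simp [sqDistRatio_self hP hB, hc]))]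
    exact zero_le
  have hk : ∀ n, s ≤ ‖X k n ω‖ ^ 2 := fun n ↦ by simpa using hvoid k n
  obtain ⟨n₀, hn₀⟩ := count_eq_one_iff.1 hc
  have hn₀t : ‖X k n₀ ω‖ ^ 2 < t := ((hn₀ n₀).2 rfl).2
  have hne : ∀ n, n ≠ n₀ → t ≤ ‖X k n ω‖ ^ 2 := fun n hn ↦ by
    by_contra! hlt
    exact hn ((hn₀ n).1 ⟨hk n, hlt⟩)
  have hr2 : nearestDist X k ω ^ 2 < t := (nearestDist_sq_le X k n₀ ω).trans_lt hn₀t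
  have hr : ‖X k n₀ ω‖ = nearestDist X k ω := by
    refine le_antisymm (le_ciInf fun n ↦ ?_) (nearestDist_le X k n₀ ω)
    by_cases hn : n = n₀
    · rw [hn]
    · exact (pow_le_pow_iff_left₀ (norm_nonneg _) (norm_nonneg _) two_ne_zero).1
        (hn₀t.le.trans (hne n hn))
  have hA : ω ∈ assocEvent P B X k := fun i hik ↦ by
    have h1 : t * sqDistRatio P B k i ≤ nearestDist X i ω ^ 2 :=
      le_nearestDist_sq fun n ↦ by simpa [hik] using hvoid i n
    have hκ := sqDistRatio_pos hP hB k i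
    -- Positivity matters: at distance zero the quotient defining the received power would be `0`.
    have h2 : 0 < nearestDist X i ω :=
      (nearestDist_nonneg X i ω).lt_of_ne fun h0 ↦ by
        rw [← h0] at h1
        have := mul_pos ht hκ
        linarith
    refine (biased_power_lt_iff hP hB hpos h2).2 (lt_of_lt_of_le ?_ h1)
    nlinarith
  rw [Set.indicator_of_mem (show ω ∈ assocEvent P B X k ∩ shellEvent X k s t from
    ⟨hA, le_nearestDist_sq hk, hr2⟩)]
  refine (boundFunctional_le (fun _ n ↦ by split_ifs <;> simp) ω).trans ?_
  refine negExp_antitone (ENNReal.tsum_le_tsum fun p ↦ ENNReal.ofReal_le_ofReal ?_)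
  have hPk := hP k
  have hPi := hP p.1
  unfold interferenceTerm
  split_ifs with h1
  · rw [mul_zero]
    exact mul_nonneg (markWeight_nonneg (by positivity) _ _) (by positivity)
  · have h2 : ¬ ‖X p.1 p.2 ω‖ ^ 2 < t * sqDistRatio P B k p.1 := by
      rcases eq_or_ne p.1 k with hik | hik
      · rw [hik, sqDistRatio_self hP hB, mul_one, not_lt]
        refine hne _ fun h3 ↦ h1 ⟨hik, ?_⟩
        rw [hik, h3, hr]
      · simpa [hik] using hvoid p.1 p.2
    rw [markWeight, if_neg h2]
    calc _ = (nearestDist X k ω ^ 2) ^ 2 *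
            (a * P p.1 / P k * ‖h p.1 p.2 ω‖ ^ 2 / ‖X p.1 p.2 ω‖ ^ 4) := by ring
      _ ≤ t ^ 2 * (a * P p.1 / P k * ‖h p.1 p.2 ω‖ ^ 2 / ‖X p.1 p.2 ω‖ ^ 4) := by gcongr
      _ = _ := by ring

end Pathwise

/-! ### Shell expectations, summation over shells, and finiteness of the interference. -/

section Bounds

variable {Ω : Type*} [MeasurableSpace Ω] {μ : Measure Ω}
variable {K : ℕ} {lam P B : Fin K → ℝ} {X : Fin K → ℕ → Ω → Plane} {h : Fin K → ℕ → Ω → ℂ}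

lemma lintegral_poissonMeasure_ne_zero_le (r : ℝ≥0) :
    ∫⁻ n : ℕ, (if (n : ℕ∞) = 0 then 0 else 1) ∂(poissonMeasure r) ≤ r := by
  have h1 : ∀ n : ℕ, (if (n : ℕ∞) = 0 then (0 : ℝ≥0∞) else 1) =
      ({0}ᶜ : Set ℕ).indicator (fun _ ↦ 1) n := fun n ↦ by
    by_cases hn : n = 0 <;> simp [hn]
  simp_rw [h1]
  rw [lintegral_indicator_const (measurableSet_singleton _).compl, one_mul,
    prob_compl_eq_one_sub (measurableSet_singleton _), poissonMeasure_singleton,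
    ← ENNReal.ofReal_one, ← ENNReal.ofReal_sub _ (by positivity), ← ENNReal.ofReal_coe_nnreal]
  refine ENNReal.ofReal_le_ofReal ?_
  have := Real.add_one_le_exp (-(r : ℝ))
  simp
  linarith

lemma lintegral_poissonMeasure_eq_one (r : ℝ≥0) :
    ∫⁻ n : ℕ, (if (n : ℕ∞) = 1 then 1 else 0) ∂(poissonMeasure r) =
      ENNReal.ofReal (r * Real.exp (-r)) := by
  have h1 : ∀ n : ℕ, (if (n : ℕ∞) = 1 then (1 : ℝ≥0∞) else 0) =
      ({1} : Set ℕ).indicator (fun _ ↦ 1) n := fun n ↦ by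
    by_cases hn : n = 1 <;> simp [hn]
  simp_rw [h1]
  rw [lintegral_indicator_const (measurableSet_singleton _), one_mul, poissonMeasure_singleton]
  congr 1
  simp [mul_comm]

/-- The contribution of tier `i` to the exponential rate, in the squared distance to the nearest
point of tier `k`, of the Laplace transform. -/
noncomputable def tierRate (lam P B : Fin K → ℝ) (a : ℝ) (k i : Fin K) : ℝ :=
  lam i * (Real.pi * sqDistRatio P B k i + tailIntegral (sqDistRatio P B k i) (a * P i / P k))

lemma tierRate_pos (hlam : ∀ i, 0 < lam i) (hP : ∀ i, 0 < P i) (hB : ∀ i, 0 < B i) (a : ℝ)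
    (k i : Fin K) : 0 < tierRate lam P B a k i :=
  mul_pos (hlam i) (add_pos_of_pos_of_nonneg
    (mul_pos Real.pi_pos (sqDistRatio_pos hP hB k i)) (tailIntegral_nonneg _ _))

lemma prod_negExp_ofReal {f : Fin K → ℝ} (hf : ∀ i, 0 ≤ f i) :
    ∏ i, negExp (ENNReal.ofReal (f i)) = ENNReal.ofReal (Real.exp (-∑ i, f i)) := by
  rw [← negExp_sum, ← ENNReal.ofReal_sum_of_nonneg (fun i _ ↦ hf i),
    negExp_ofReal (Finset.sum_nonneg fun i _ ↦ hf i)]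

/-- A shell of area $\pi d$ is nonempty with probability at most $\lambda_k\pi d$. The factor
$e^{\lambda_k\pi d}$ pays for the interferers omitted from the annulus. -/
lemma IsNetwork.lintegral_boundFunctional_upper_le [IsProbabilityMeasure μ]
    (hnet : IsNetwork μ lam X h) (hlam : ∀ i, 0 < lam i) (hP : ∀ i, 0 < P i) (hB : ∀ i, 0 < B i)
    {a : ℝ} (ha : 0 ≤ a) (k : Fin K) {s d : ℝ} (hs : 0 ≤ s) (hd : 0 ≤ d) :
    ∫⁻ ω, boundFunctional X h (fun i ↦ s * sqDistRatio P B k i)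
      (fun i ↦ if i = k then s + d else s * sqDistRatio P B k i) (fun i ↦ s ^ 2 * (a * P i / P k))
      (fun i n ↦ if i = k then if n = 0 then 0 else 1 else 1) ω ∂μ ≤
    ENNReal.ofReal (lam k * Real.pi * d *
      Real.exp (lam k * Real.pi * d - s * ∑ i, tierRate lam P B a k i)) := by
  have hQ : ∀ i, 0 ≤ a * P i / P k := fun i ↦
    div_nonneg (mul_nonneg ha (hP i).le) (hP k).le
  have hκ := fun i ↦ (sqDistRatio_pos hP hB k i).le
  have hint := hnet.lintegral_prod_void_mul_negExp_mark (fun i ↦ (hlam i).le)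
    (b := fun i ↦ s * sqDistRatio P B k i)
    (e := fun i ↦ if i = k then s + d else s * sqDistRatio P B k i)
    (Q := fun i ↦ s ^ 2 * (a * P i / P k))
    (φ := fun i n ↦ if i = k then if n = 0 then 0 else 1 else 1)
    (fun i ↦ mul_nonneg hs (hκ i))
    (fun i ↦ by
      split_ifs with hik
      · rw [hik, sqDistRatio_self hP hB]; linarith
      · rfl)
    (fun i ↦ mul_nonneg (sq_nonneg s) (hQ i))
    (fun i n ↦ by split_ifs <;> simp)
  refine hint.trans_le ?_
  rw [Finset.prod_mul_distrib, Finset.prod_eq_single k (fun i _ hik ↦ by simp [hik]) (by simp),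
    prod_negExp_ofReal, ENNReal.ofReal_mul (by have := hlam k; positivity)]
  swap
  · exact fun i ↦ mul_nonneg (hlam i).le (add_nonneg
      (mul_nonneg Real.pi_nonneg (mul_nonneg hs (hκ i))) (tailIntegral_nonneg _ _))
  refine mul_le_mul' ?_ (ENNReal.ofReal_le_ofReal (Real.exp_le_exp.2 ?_))
  · simp only [if_true]
    refine (lintegral_poissonMeasure_ne_zero_le _).trans (le_of_eq ?_)
    rw [sqDistRatio_self hP hB, ← ENNReal.ofReal]
    congr 1
    ring
  · have h1 : ∀ i, s * tierRate lam P B a k i - (if i = k then lam k * Real.pi * d else 0) ≤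
        lam i * (Real.pi * (s * sqDistRatio P B k i) +
          tailIntegral (if i = k then s + d else s * sqDistRatio P B k i)
            (s ^ 2 * (a * P i / P k))) := fun i ↦ by
      have h2 := tailIntegral_mul hs (sqDistRatio P B k i) (a * P i / P k)
      split_ifs with hik
      · subst hik
        have h3 := tailIntegral_le_add hd s (s ^ 2 * (a * P i / P i))
        rw [tierRate]
        rw [sqDistRatio_self hP hB, mul_one] at *
        have := mul_le_mul_of_nonneg_left h3 (hlam i).le
        rw [h2] at this
        linarith
      · rw [h2, tierRate]
        linarith
    have h4 := Finset.sum_le_sum fun i (_ : i ∈ Finset.univ) ↦ h1 i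
    rw [Finset.sum_sub_distrib, ← Finset.mul_sum, Finset.sum_ite_eq' Finset.univ k] at h4
    simp only [Finset.mem_univ, if_true] at h4
    linarith

lemma IsNetwork.lintegral_boundFunctional_lower_eq [IsProbabilityMeasure μ]
    (hnet : IsNetwork μ lam X h) (hlam : ∀ i, 0 < lam i) (hP : ∀ i, 0 < P i) (hB : ∀ i, 0 < B i)
    {a : ℝ} (ha : 0 ≤ a) (k : Fin K) {s t : ℝ} (hs : 0 ≤ s) (hst : s ≤ t) :
    ∫⁻ ω, boundFunctional X h (fun i ↦ if i = k then s else t * sqDistRatio P B k i)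
      (fun i ↦ t * sqDistRatio P B k i) (fun i ↦ t ^ 2 * (a * P i / P k))
      (fun i n ↦ if i = k then if n = 1 then 1 else 0 else 1) ω ∂μ =
    ENNReal.ofReal (lam k * Real.pi * (t - s) *
      Real.exp (-(t * ∑ i, tierRate lam P B a k i))) := by
  have ht := hs.trans hst
  have hQ : ∀ i, 0 ≤ a * P i / P k := fun i ↦
    div_nonneg (mul_nonneg ha (hP i).le) (hP k).le
  have hκ := fun i ↦ (sqDistRatio_pos hP hB k i).le
  have hb : ∀ i, 0 ≤ if i = k then s else t * sqDistRatio P B k i := fun i ↦ by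
    split_ifs
    exacts [hs, mul_nonneg ht (hκ i)]
  have hint := hnet.lintegral_prod_void_mul_negExp_mark (fun i ↦ (hlam i).le)
    (b := fun i ↦ if i = k then s else t * sqDistRatio P B k i)
    (e := fun i ↦ t * sqDistRatio P B k i)
    (Q := fun i ↦ t ^ 2 * (a * P i / P k))
    (φ := fun i n ↦ if i = k then if n = 1 then 1 else 0 else 1)
    hb
    (fun i ↦ by
      split_ifs with hik
      · rw [hik, sqDistRatio_self hP hB]; linarith
      · rfl)
    (fun i ↦ mul_nonneg (sq_nonneg t) (hQ i))
    (fun i n ↦ by split_ifs <;> simp)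
  refine hint.trans ?_
  rw [Finset.prod_mul_distrib, Finset.prod_eq_single k (fun i _ hik ↦ by simp [hik]) (by simp),
    prod_negExp_ofReal]
  swap
  · exact fun i ↦ mul_nonneg (hlam i).le (add_nonneg
      (mul_nonneg Real.pi_nonneg (hb i)) (tailIntegral_nonneg _ _))
  have hm : 0 ≤ lam k * (Real.pi * (t - s)) :=
    mul_nonneg (hlam k).le (mul_nonneg Real.pi_nonneg (sub_nonneg.2 hst))
  simp only [if_true]
  rw [lintegral_poissonMeasure_eq_one, sqDistRatio_self hP hB, mul_one, Real.coe_toNNReal _ hm,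
    ← ENNReal.ofReal_mul (by positivity), mul_assoc _ (Real.exp _), ← Real.exp_add]
  -- The term subtracted for $i=k$ cancels the $e^{-\lambda_k\pi(t-s)}$ of the one-point Poisson
  -- probability, leaving exactly $e^{-tC}$.
  have h1 : ∀ i, lam i * (Real.pi * (if i = k then s else t * sqDistRatio P B k i) +
          tailIntegral (t * sqDistRatio P B k i) (t ^ 2 * (a * P i / P k))) =
      t * tierRate lam P B a k i - (if i = k then lam k * (Real.pi * (t - s)) else 0) := fun i ↦ by
    rw [tailIntegral_mul ht, tierRate]
    split_ifs with hik
    · subst hik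
      rw [sqDistRatio_self hP hB]
      ring
    · ring
  simp_rw [h1]
  rw [Finset.sum_sub_distrib, ← Finset.mul_sum, Finset.sum_ite_eq' Finset.univ k]
  simp only [Finset.mem_univ, if_true]
  congr 1
  ring_nf

lemma measurable_nearestDist (hX : ∀ i n, Measurable (X i n)) (i : Fin K) :
    Measurable (nearestDist X i) :=
  Measurable.iInf fun n ↦ (hX i n).norm

lemma measurableSet_assocEvent (hX : ∀ i n, Measurable (X i n)) (k : Fin K) :
    MeasurableSet (assocEvent P B X k) := by
  have := measurable_nearestDist hX
  simp only [assocEvent, Set.ofPred_forall]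
  exact MeasurableSet.iInter fun i ↦ MeasurableSet.iInter fun _ ↦
    measurableSet_lt (by fun_prop) (by fun_prop)

lemma measurableSet_shellEvent (hX : ∀ i n, Measurable (X i n)) (k : Fin K) (s t : ℝ) :
    MeasurableSet (shellEvent X k s t) := by
  have := measurable_nearestDist hX
  exact (measurableSet_le (f := fun _ : Ω ↦ s) measurable_const
    ((this k).pow_const 2)).inter (measurableSet_lt ((this k).pow_const 2) measurable_const)

/-- A disc of area $\pi\varepsilon$ contains a point with probability at most
$\lambda_i\pi\varepsilon$. Positivity lets the association rule be rewritten in squared distances.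
-/
lemma IsNetwork.ae_nearestDist_pos [IsProbabilityMeasure μ] (hnet : IsNetwork μ lam X h)
    (hlam : ∀ i, 0 < lam i) (i : Fin K) : ∀ᵐ ω ∂μ, 0 < nearestDist X i ω := by
  have hX := hnet.tier_poisson i
  have hlami := hlam i
  have hm : Measurable (nearestDist X i) :=
    Measurable.iInf fun n ↦ (hX.measurable n).norm
  have hle : ∀ ε : ℝ, 0 < ε →
      μ {ω | ¬ 0 < nearestDist X i ω} ≤ ENNReal.ofReal (lam i * (Real.pi * ε)) := by
    intro ε hε
    have hbound := hX.lintegral_count_mul_negExp_tsum hlami.le (measurableSet_annulus 0 ε)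
      (isBounded_annulus _ _) (φ := fun n ↦ if n = 0 then 0 else 1)
      (fun n ↦ by split_ifs <;> simp) (g := fun _ ↦ 0) measurable_const (fun _ _ ↦ rfl)
    simp only [tsum_zero, negExp_zero, mul_one, tsub_self, lintegral_zero, mul_zero,
      volume_annulus le_rfl hε.le, sub_zero,
      ENNReal.toReal_ofReal (mul_nonneg Real.pi_nonneg hε.le)] at hbound
    have hset : MeasurableSet {ω | ¬ 0 < nearestDist X i ω} :=
      (measurableSet_lt measurable_const hm).compl
    rw [← lintegral_indicator_one hset]
    refine le_trans (lintegral_mono fun ω ↦ ?_)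
      (hbound.le.trans (lintegral_poissonMeasure_ne_zero_le _))
    by_cases hω : 0 < nearestDist X i ω
    · simp [hω]
    · have h0 : nearestDist X i ω ^ 2 < ε := by
        rw [le_antisymm (not_lt.1 hω) (nearestDist_nonneg X i ω)]
        simpa using hε
      obtain ⟨n, hn⟩ := exists_normSq_lt_of_nearestDist_sq_lt h0
      have hc : count (X i) (annulus 0 ε) ω ≠ 0 :=
        count_ne_zero_iff.2 ⟨n, by positivity, hn⟩
      simp only [if_neg hc]
      exact Set.indicator_le' (fun _ _ ↦ le_rfl) (fun _ _ ↦ zero_le) ω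
  refine le_antisymm (ge_of_tendsto (x := 𝓝[>] (0 : ℝ)) (f := fun ε ↦
    ENNReal.ofReal (lam i * (Real.pi * ε))) ?_ ?_) zero_le
  · have : Tendsto (fun ε : ℝ ↦ ENNReal.ofReal (lam i * (Real.pi * ε))) (𝓝 0)
        (𝓝 (ENNReal.ofReal (lam i * (Real.pi * 0)))) :=
      (ENNReal.continuous_ofReal.comp (by fun_prop)).tendsto 0
    rw [mul_zero, mul_zero, ENNReal.ofReal_zero] at this
    exact this.mono_left nhdsWithin_le_nhds
  · filter_upwards [self_mem_nhdsWithin] with ε hε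
    exact hle ε hε

lemma lintegral_assocEvent_eq_tsum (hX : ∀ i n, Measurable (X i n)) (k : Fin K) {d : ℝ}
    (hd : 0 < d) (f : Ω → ℝ≥0∞) :
    ∫⁻ ω in assocEvent P B X k, f ω ∂μ =
      ∑' j : ℕ, ∫⁻ ω, (assocEvent P B X k ∩ shellEvent X k (j * d) (j * d + d)).indicator f ω ∂μ := by
  have hm : ∀ j : ℕ, MeasurableSet (assocEvent P B X k ∩ shellEvent X k (j * d) (j * d + d)) :=
    fun j ↦ (measurableSet_assocEvent hX k).inter (measurableSet_shellEvent hX k _ _)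
  simp_rw [lintegral_indicator (hm _)]
  rw [← lintegral_iUnion hm, ← Set.inter_iUnion, iUnion_shellEvent hd, Set.inter_univ]
  exact fun i j hij ↦ (pairwise_disjoint_shellEvent hd k hij).mono Set.inter_subset_right
    Set.inter_subset_right

lemma tsum_ofReal_mul_exp {c r : ℝ} (hc : 0 ≤ c) (hr : 0 < r) :
    ∑' j : ℕ, ENNReal.ofReal (c * Real.exp (-(j * r))) =
      ENNReal.ofReal (c * (1 - Real.exp (-r))⁻¹) := by
  have h1 : ∀ j : ℕ, Real.exp (-(j * r)) = Real.exp (-r) ^ j := fun j ↦ by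
    rw [← Real.exp_nat_mul]; ring_nf
  simp_rw [h1]
  have hs := (hasSum_geometric_of_lt_one (Real.exp_pos (-r)).le
    (Real.exp_lt_one_iff.2 (neg_lt_zero.2 hr))).mul_left c
  rw [← ENNReal.ofReal_tsum_of_nonneg (fun j ↦ by positivity) hs.summable, hs.tsum_eq]

/-- The Laplace transform of the interference, restricted to the association with tier `k`. -/
lemma IsNetwork.lintegral_expInterference [IsProbabilityMeasure μ]
    (hnet : IsNetwork μ lam X h) (hlam : ∀ i, 0 < lam i) (hP : ∀ i, 0 < P i) (hB : ∀ i, 0 < B i)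
    {a : ℝ} (ha : 0 ≤ a) (k : Fin K) :
    ∫⁻ ω in assocEvent P B X k, expInterference P X h a k ω ∂μ =
      ENNReal.ofReal (lam k * Real.pi / ∑ i, tierRate lam P B a k i) := by
  have hX : ∀ i n, Measurable (X i n) := fun i ↦ (hnet.tier_poisson i).measurable
  have hlk := hlam k
  set C := ∑ i, tierRate lam P B a k i with hC
  have hCpos : 0 < C :=
    Finset.sum_pos (fun i _ ↦ tierRate_pos hlam hP hB a k i) ⟨k, Finset.mem_univ k⟩
  have hpos : ∀ᵐ ω ∂μ, ∀ i, 0 < nearestDist X i ω :=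
    ae_all_iff.2 fun i ↦ hnet.ae_nearestDist_pos hlam i
  have hupper : ∀ d : ℝ, 0 < d → ∫⁻ ω in assocEvent P B X k, expInterference P X h a k ω ∂μ ≤
      ENNReal.ofReal (lam k * Real.pi / C * Real.exp ((lam k * Real.pi + C) * d)) := by
    intro d hd
    rw [lintegral_assocEvent_eq_tsum hX k hd]
    calc _ ≤ ∑' j : ℕ, ENNReal.ofReal
            (lam k * Real.pi * d * Real.exp (lam k * Real.pi * d) * Real.exp (-(j * (d * C)))) := by
          refine ENNReal.tsum_le_tsum fun j ↦ ?_
          refine le_trans (lintegral_mono_ae ?_) ((hnet.lintegral_boundFunctional_upper_le hlam hP hB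
            ha k (s := j * d) (by positivity) hd.le).trans_eq ?_)
          · filter_upwards [hpos] with ω hω
            refine Set.indicator_apply_le' (fun hmem ↦ ?_) (fun _ ↦ zero_le)
            exact expInterference_le_boundFunctional hP hB ha (by positivity) hω hmem.2 hmem.1
          · rw [mul_assoc _ (Real.exp _), ← Real.exp_add]
            congr 3
            ring
      _ = ENNReal.ofReal (lam k * Real.pi * d * Real.exp (lam k * Real.pi * d) *
            (1 - Real.exp (-(d * C)))⁻¹) :=
          tsum_ofReal_mul_exp (by positivity) (by positivity)
      _ ≤ _ := by
          refine ENNReal.ofReal_le_ofReal ?_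
          -- From $x+1\le e^x$ one gets $xe^{-x}\le 1-e^{-x}$, which bounds the geometric sum from
          -- above with the right limit as $d\to0$.
          have h1 : d * C * Real.exp (-(d * C)) ≤ 1 - Real.exp (-(d * C)) := by
            have h2 := Real.add_one_le_exp (d * C)
            have h3 := mul_le_mul_of_nonneg_right h2 (Real.exp_pos (-(d * C))).le
            rw [← Real.exp_add, add_neg_cancel, Real.exp_zero] at h3
            linarith
          calc _ ≤ lam k * Real.pi * d * Real.exp (lam k * Real.pi * d) *
                (d * C * Real.exp (-(d * C)))⁻¹ := by gcongr
            _ = _ := by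
                rw [add_mul, Real.exp_add, mul_comm d C, Real.exp_neg]
                field_simp
  have hlower : ∀ d : ℝ, 0 < d → ENNReal.ofReal (lam k * Real.pi / C * Real.exp (-(C * d))) ≤
      ∫⁻ ω in assocEvent P B X k, expInterference P X h a k ω ∂μ := by
    intro d hd
    rw [lintegral_assocEvent_eq_tsum hX k hd]
    calc _ ≤ ENNReal.ofReal (lam k * Real.pi * d * Real.exp (-(C * d)) *
            (1 - Real.exp (-(d * C)))⁻¹) := by
          refine ENNReal.ofReal_le_ofReal ?_
          -- The opposite estimate $1-e^{-x}\le x$ bounds the geometric sum from below.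
          have h1 : 1 - Real.exp (-(d * C)) ≤ d * C := by
            have := Real.add_one_le_exp (-(d * C))
            linarith
          have h2 : 0 < 1 - Real.exp (-(d * C)) :=
            sub_pos.2 (Real.exp_lt_one_iff.2 (neg_lt_zero.2 (by positivity)))
          calc _ = lam k * Real.pi * d * Real.exp (-(C * d)) * (d * C)⁻¹ := by field_simp
            _ ≤ _ := by gcongr
      _ = ∑' j : ℕ, ENNReal.ofReal
            (lam k * Real.pi * d * Real.exp (-(C * d)) * Real.exp (-(j * (d * C)))) :=
          (tsum_ofReal_mul_exp (by positivity) (by positivity)).symm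
      _ ≤ _ := by
          refine ENNReal.tsum_le_tsum fun j ↦ ?_
          have h1 := hnet.lintegral_boundFunctional_lower_eq hlam hP hB ha k (s := j * d)
            (t := j * d + d) (by positivity) (by linarith)
          refine le_trans (le_of_eq ?_) (h1.ge.trans (lintegral_mono_ae ?_))
          · rw [mul_assoc _ (Real.exp _), ← Real.exp_add, add_sub_cancel_left]
            congr 3
            ring
          · filter_upwards [hpos] with ω hω
            exact boundFunctional_le_expInterference hP hB ha (by positivity) (hω k)
  have hlim : ∀ f : ℝ → ℝ, Continuous f → f 0 = 0 → Tendsto (fun d ↦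
      ENNReal.ofReal (lam k * Real.pi / C * Real.exp (f d))) (𝓝[>] 0)
      (𝓝 (ENNReal.ofReal (lam k * Real.pi / C))) := fun f hf hf0 ↦ by
    have h1 : Continuous fun d ↦ ENNReal.ofReal (lam k * Real.pi / C * Real.exp (f d)) :=
      ENNReal.continuous_ofReal.comp (by fun_prop)
    have h2 := h1.tendsto 0
    rw [hf0, Real.exp_zero, mul_one] at h2
    exact h2.mono_left nhdsWithin_le_nhds
  refine le_antisymm
    (ge_of_tendsto (hlim (fun d ↦ (lam k * Real.pi + C) * d) (by fun_prop) (by simp)) ?_)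
    (le_of_tendsto (hlim (fun d ↦ -(C * d)) (by fun_prop) (by simp)) ?_)
  · filter_upwards [self_mem_nhdsWithin] with d hd using hupper d hd
  · filter_upwards [self_mem_nhdsWithin] with d hd using hlower d hd

/-- The total received power is almost surely finite. -/
lemma IsNetwork.ae_summable_power [IsProbabilityMeasure μ] (hnet : IsNetwork μ lam X h)
    (hlam : ∀ i, 0 < lam i) (hP : ∀ i, 0 < P i) :
    ∀ᵐ ω ∂μ, Summable fun p : Fin K × ℕ ↦ P p.1 * ‖h p.1 p.2 ω‖ ^ 2 / ‖X p.1 p.2 ω‖ ^ 4 := by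
  have hnn : ∀ ω (p : Fin K × ℕ), 0 ≤ P p.1 * ‖h p.1 p.2 ω‖ ^ 2 / ‖X p.1 p.2 ω‖ ^ 4 :=
    fun ω p ↦ by
      have := hP p.1
      positivity
  let I : Ω → ℝ≥0∞ := fun ω ↦
    ∑' p : Fin K × ℕ, ENNReal.ofReal (P p.1 * ‖h p.1 p.2 ω‖ ^ 2 / ‖X p.1 p.2 ω‖ ^ 4)
  have hIm : Measurable I := Measurable.tsum fun p ↦ by
    have h1 := hnet.fading_measurable p.1 p.2
    have h2 := (hnet.tier_poisson p.1).measurable p.2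
    fun_prop
  have hset : MeasurableSet {ω | I ω = ⊤}ᶜ := (hIm (measurableSet_singleton ⊤)).compl
  -- $\mathbb P(I<\infty)\ge\mathbb E\,e^{-sI}$ for every $s>0$, and the right side tends to $1$ as
  -- $s\to0$.
  have hle : ∀ s : ℝ, 0 < s →
      ENNReal.ofReal (Real.exp (-∑ i, lam i * (Real.pi * 0 + tailIntegral 0 (s * P i)))) ≤
        μ {ω | I ω = ⊤}ᶜ := by
    intro s hs
    have hint := hnet.lintegral_prod_void_mul_negExp_mark (fun i ↦ (hlam i).le)
      (b := fun _ ↦ 0) (e := fun _ ↦ 0) (Q := fun i ↦ s * P i) (φ := fun _ _ ↦ 1)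
      (fun _ ↦ le_rfl) (fun _ ↦ le_rfl) (fun i ↦ (mul_pos hs (hP i)).le) (fun _ _ ↦ le_rfl)
    simp only [lintegral_const, measure_univ, mul_one, one_mul] at hint
    rw [prod_negExp_ofReal (fun i ↦ mul_nonneg (hlam i).le
      (add_nonneg (by simp) (tailIntegral_nonneg _ _)))] at hint
    rw [← hint, ← lintegral_indicator_one hset]
    refine lintegral_mono fun ω ↦ ?_
    by_cases hω : I ω = ⊤
    · have h1 : ∑' p : Fin K × ℕ, ENNReal.ofReal
          (markWeight 0 (s * P p.1) (X p.1 p.2 ω) * ‖h p.1 p.2 ω‖ ^ 2) =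
          ENNReal.ofReal s * I ω := by
        rw [← ENNReal.tsum_mul_left]
        refine tsum_congr fun p ↦ ?_
        rw [← ENNReal.ofReal_mul hs.le, markWeight, if_neg (not_lt.2 (by positivity))]
        congr 1
        ring
      rw [h1, hω, ENNReal.mul_top (by simpa using hs), negExp_top, mul_zero]
      exact zero_le
    · rw [Set.indicator_of_mem (show ω ∈ {ω | I ω = ⊤}ᶜ from hω)]
      exact mul_le_one' (Finset.prod_le_one' fun i _ ↦ negExp_le_one _) (negExp_le_one _)
  have hone : μ {ω | I ω = ⊤}ᶜ = 1 := by
    refine le_antisymm prob_le_one (le_of_tendsto (x := 𝓝[>] (0 : ℝ)) (f := fun s : ℝ ↦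
      ENNReal.ofReal (Real.exp (-∑ i, lam i * (Real.pi * 0 + tailIntegral 0 (s * P i))))) ?_ ?_)
    · have h1 : Continuous fun s : ℝ ↦
          ENNReal.ofReal (Real.exp (-∑ i, lam i * (Real.pi * 0 + tailIntegral 0 (s * P i)))) := by
        refine ENNReal.continuous_ofReal.comp ?_
        -- With $e=0$ the arctangent vanishes and the tail integral is a multiple of $\sqrt s$, so
        -- continuity at $s=0$ is plain.
        simp only [tailIntegral, zero_div, Real.arctan_zero]
        fun_prop
      have h2 := h1.tendsto 0
      rw [show ENNReal.ofReal (Real.exp (-∑ i, lam i *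
        (Real.pi * 0 + tailIntegral 0 (0 * P i)))) = 1 by simp [tailIntegral]] at h2
      exact h2.mono_left nhdsWithin_le_nhds
    · filter_upwards [self_mem_nhdsWithin] with s hs using hle s hs
  have hzero : μ {ω | I ω = ⊤} = 0 := (prob_compl_eq_one_iff₀
    (hIm (measurableSet_singleton ⊤)).nullMeasurableSet).1 hone
  have hae : ∀ᵐ ω ∂μ, I ω ≠ ⊤ := by
    rw [ae_iff]
    simpa only [ne_eq, not_not] using hzero
  filter_upwards [hae] with ω hω
  refine (ENNReal.summable_toReal hω).congr fun p ↦ ?_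
  exact ENNReal.toReal_ofReal (hnn ω p)

end Bounds

/-! ### Closed forms of the association probabilities and Laplace transforms. -/

section Main

variable {Ω : Type*} [MeasurableSpace Ω] {μ : Measure Ω}
variable {K : ℕ} {lam P B : Fin K → ℝ} {X : Fin K → ℕ → Ω → Plane} {h : Fin K → ℕ → Ω → ℂ}

lemma measurable_interferenceTerm (hX : ∀ i n, Measurable (X i n)) (hh : ∀ i n, Measurable (h i n))
    (k : Fin K) (p : Fin K × ℕ) : Measurable fun ω ↦ interferenceTerm P X h k ω p := by
  have h1 := hX p.1 p.2
  have h2 := hh p.1 p.2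
  refine Measurable.ite ?_ measurable_const (by fun_prop)
  exact (MeasurableSet.const _).inter
    (measurableSet_eq_fun h1.norm (measurable_nearestDist hX k))

lemma measurable_expInterference (hX : ∀ i n, Measurable (X i n))
    (hh : ∀ i n, Measurable (h i n)) (a : ℝ) (k : Fin K) :
    Measurable (expInterference P X h a k) := by
  refine measurable_negExp.comp (Measurable.tsum fun p ↦ ?_)
  have h1 := measurable_nearestDist hX k
  have h2 := measurable_interferenceTerm (P := P) hX hh k p
  fun_prop

lemma IsNetwork.ae_summable_interferenceTerm [IsProbabilityMeasure μ] (hnet : IsNetwork μ lam X h)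
    (hlam : ∀ i, 0 < lam i) (hP : ∀ i, 0 < P i) (k : Fin K) :
    ∀ᵐ ω ∂μ, Summable (interferenceTerm P X h k ω) := by
  filter_upwards [hnet.ae_summable_power hlam hP] with ω hω
  exact hω.of_nonneg_of_le (interferenceTerm_nonneg (fun i ↦ (hP i).le) k ω)
    (interferenceTerm_le (fun i ↦ (hP i).le) k ω)

/-- At $a=0$ the integrand is $1$, so the restricted Laplace transform is the probability of the
event itself. -/
lemma IsNetwork.assocProb_eq_div_tierRate [IsProbabilityMeasure μ] (hnet : IsNetwork μ lam X h)
    (hlam : ∀ i, 0 < lam i) (hP : ∀ i, 0 < P i) (hB : ∀ i, 0 < B i) (k : Fin K) :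
    assocProb μ P B X k = lam k * Real.pi / ∑ i, tierRate lam P B 0 k i := by
  have h1 := hnet.lintegral_expInterference hlam hP hB le_rfl k
  simp only [expInterference, zero_mul, zero_div, ENNReal.ofReal_zero, tsum_zero, negExp_zero,
    setLIntegral_one] at h1
  rw [assocProb, measureReal_def, h1, ENNReal.toReal_ofReal]
  exact div_nonneg (mul_nonneg (hlam k).le Real.pi_nonneg)
    (Finset.sum_nonneg fun i _ ↦ (tierRate_pos hlam hP hB 0 k i).le)

lemma IsNetwork.tierLT_eq_div_tierRate [IsProbabilityMeasure μ] (hnet : IsNetwork μ lam X h)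
    (hlam : ∀ i, 0 < lam i) (hP : ∀ i, 0 < P i) (hB : ∀ i, 0 < B i) {a : ℝ} (ha : 0 ≤ a)
    (k : Fin K) :
    tierLT μ P B X h a k =
      (assocProb μ P B X k)⁻¹ * (lam k * Real.pi / ∑ i, tierRate lam P B a k i) := by
  have hX : ∀ i n, Measurable (X i n) := fun i ↦ (hnet.tier_poisson i).measurable
  rw [tierLT, ProbabilityTheory.cond, integral_smul_measure, ENNReal.toReal_inv, assocProb,
    measureReal_def, smul_eq_mul]
  congr 1
  -- Almost sure summability is essential here: a divergent real `tsum` would be `0`, whereas the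
  -- extended sum would be `⊤`.
  have hae : ∀ᵐ ω ∂(μ.restrict (assocEvent P B X k)),
      Real.exp (-(a * nearestDist X k ω ^ 4 / P k * interference P X h k ω)) =
        (expInterference P X h a k ω).toReal := by
    filter_upwards [ae_restrict_of_ae (hnet.ae_summable_interferenceTerm hlam hP k)] with ω hω
    exact (toReal_expInterference hP ha hω).symm
  rw [integral_congr_ae hae, integral_toReal
    (measurable_expInterference hX hnet.fading_measurable a k).aemeasurable
    (ae_of_all _ fun ω ↦ (negExp_ne_top _).lt_top),
    hnet.lintegral_expInterference hlam hP hB ha k, ENNReal.toReal_ofReal]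
  exact div_nonneg (mul_nonneg (hlam k).le Real.pi_nonneg)
    (Finset.sum_nonneg fun i _ ↦ (tierRate_pos hlam hP hB a k i).le)

/-- The identity $\pi/2-\arctan(1/x)=\arctan x$ for $x>0$, with $x=\sqrt{aB_k/B_i}$, turns the tail
integral into the stated form; at $x=0$ both sides vanish. -/
lemma tierRate_eq (hP : ∀ i, 0 < P i) (hB : ∀ i, 0 < B i) (a : ℝ) (k i : Fin K) :
    tierRate lam P B a k i = Real.pi / √(B k * P k) * (lam i * √(B i * P i) *
      (1 + √(a * B k / B i) * Real.arctan √(a * B k / B i))) := by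
  have hk := hP k
  have hi := hP i
  have hbk := hB k
  have hbi := hB i
  have hκ : sqDistRatio P B k i = √(B i * P i) / √(B k * P k) := by
    rw [sqDistRatio, Real.sqrt_div (by positivity)]
  have hm : √(a * P i / P k) = sqDistRatio P B k i * √(a * B k / B i) := by
    rw [sqDistRatio, ← Real.sqrt_mul (by positivity)]
    congr 1
    field_simp
  have hT : tailIntegral (sqDistRatio P B k i) (a * P i / P k) =
      Real.pi * sqDistRatio P B k i * (√(a * B k / B i) * Real.arctan √(a * B k / B i)) := by
    have hpos := sqDistRatio_pos hP hB k i
    rw [tailIntegral, hm]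
    rcases (Real.sqrt_nonneg (a * B k / B i)).eq_or_lt with h0 | h0
    · simp [← h0]
    · rw [← Real.arctan_inv_of_pos (div_pos hpos (mul_pos hpos h0)), inv_div,
        mul_div_cancel_left₀ _ hpos.ne']
      ring
  rw [tierRate, hT, hκ]
  ring

lemma div_sum_tierRate (hP : ∀ i, 0 < P i) (hB : ∀ i, 0 < B i) (a : ℝ) (k : Fin K) :
    lam k * Real.pi / ∑ i, tierRate lam P B a k i = lam k * √(B k * P k) /
      ∑ i, lam i * √(B i * P i) * (1 + √(a * B k / B i) * Real.arctan √(a * B k / B i)) := by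
  have h1 : 0 < √(B k * P k) := Real.sqrt_pos.2 (mul_pos (hB k) (hP k))
  simp_rw [tierRate_eq hP hB]
  rw [← Finset.mul_sum, ← div_div]
  congr 1
  have := Real.pi_ne_zero
  field_simp

end Main

end MultiTier

theorem mainTheorem7 {Ω : Type*} [MeasurableSpace Ω] (μ : Measure Ω) [IsProbabilityMeasure μ]
    {K : ℕ} (hK : 1 ≤ K) (lam P B : Fin K → ℝ)
    (hlam : ∀ i, 0 < lam i) (hP : ∀ i, 0 < P i) (hB : ∀ i, 0 < B i)
    (X : Fin K → ℕ → Ω → MultiTier.Plane) (h : Fin K → ℕ → Ω → ℂ)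
    (hnet : MultiTier.IsNetwork μ lam X h) (a : ℝ) (ha : 0 ≤ a) :
    (∀ k, ∀ᵐ ω ∂μ, Summable (MultiTier.interferenceTerm P X h k ω)) ∧
    (∀ k, MultiTier.assocProb μ P B X k =
      lam k * √(B k * P k) / ∑ i, lam i * √(B i * P i)) ∧
    (∀ k, MultiTier.tierLT μ P B X h a k =
      (∑ i, √(B i * P i) * lam i) /
        ∑ l, √(B l * P l) * lam l *
          (1 + √(a * B k / B l) * Real.arctan √(a * B k / B l))) ∧
    MultiTier.averagedLT μ P B X h a =
      ∑ k, (∑ i, lam i / lam k * √(B i * P i / (B k * P k)) *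
          (1 + √(a * B k / B i) * Real.arctan √(a * B k / B i)))⁻¹ ∧
    ((∀ i j, B i = B j) →
      MultiTier.averagedLT μ P B X h a = 1 / (1 + √a * Real.arctan √a)) := by
  have hw : ∀ i, 0 < lam i * √(B i * P i) := fun i ↦
    mul_pos (hlam i) (Real.sqrt_pos.2 (mul_pos (hB i) (hP i)))
  have hone : ∀ x : ℝ, 0 < 1 + √x * Real.arctan √x := fun x ↦
    add_pos_of_pos_of_nonneg one_pos
      (mul_nonneg (Real.sqrt_nonneg _) (Real.arctan_nonneg.2 (Real.sqrt_nonneg _)))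
  have hne : (Finset.univ : Finset (Fin K)).Nonempty := ⟨⟨0, hK⟩, Finset.mem_univ _⟩
  have hsum : 0 < ∑ i, lam i * √(B i * P i) := Finset.sum_pos (fun i _ ↦ hw i) hne
  have hassoc : ∀ k, MultiTier.assocProb μ P B X k =
      lam k * √(B k * P k) / ∑ i, lam i * √(B i * P i) := fun k ↦ by
    rw [hnet.assocProb_eq_div_tierRate hlam hP hB, MultiTier.div_sum_tierRate hP hB]
    simp
  -- The normalisation of the conditional expectation cancels against $\mathcal A_k$, so each term
  -- of the average is already a single quotient.
  have htier : ∀ k, MultiTier.assocProb μ P B X k * MultiTier.tierLT μ P B X h a k =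
      lam k * √(B k * P k) / ∑ i, lam i * √(B i * P i) *
        (1 + √(a * B k / B i) * Real.arctan √(a * B k / B i)) := fun k ↦ by
    rw [hnet.tierLT_eq_div_tierRate hlam hP hB ha, ← mul_assoc, mul_inv_cancel₀, one_mul,
      MultiTier.div_sum_tierRate hP hB]
    rw [hassoc]
    exact (div_pos (hw k) hsum).ne'
  refine ⟨hnet.ae_summable_interferenceTerm hlam hP, hassoc, fun k ↦ ?_, ?_, fun hBB ↦ ?_⟩
  · have h1 := htier k
    have hwk := (hw k).ne'
    have h2 : 0 < ∑ i, lam i * √(B i * P i) *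
        (1 + √(a * B k / B i) * Real.arctan √(a * B k / B i)) :=
      Finset.sum_pos (fun i _ ↦ mul_pos (hw i) (hone _)) hne
    simp_rw [mul_comm √(B _ * P _) (lam _)]
    rw [hassoc, div_mul_eq_mul_div, div_eq_div_iff hsum.ne' h2.ne', mul_assoc, mul_assoc,
      mul_assoc, mul_right_inj' (hlam k).ne',
      mul_right_inj' (Real.sqrt_pos.2 (mul_pos (hB k) (hP k))).ne'] at h1
    rw [eq_div_iff h2.ne', h1]
  · refine Finset.sum_congr rfl fun k _ ↦ ?_
    rw [htier, ← inv_div, Finset.sum_div]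
    congr 1
    refine Finset.sum_congr rfl fun i _ ↦ ?_
    rw [Real.sqrt_div (mul_pos (hB i) (hP i)).le]
    ring
  · have hs : ∀ k i, a * B k / B i = a := fun k i ↦ by
      rw [hBB k i, mul_div_cancel_right₀ _ (hB i).ne']
    rw [MultiTier.averagedLT]
    simp_rw [htier, hs]
    rw [← Finset.sum_mul, ← Finset.sum_div, ← div_div, div_self hsum.ne']
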